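/- Let $A$ be a unital commutative $\mathbb{R}$-algebra. Let $X(A)$ be the set of all unital $\mathbb{R}$-algebra homomorphisms $A\to\mathbb{R}$, endowed with the weakest topology making all evaluations $\hat a:\alpha\mapsto\alpha(a)$, $a\in A$, continuous, and with its Borel $\sigma$-algebra; use the same notation for subalgebras of $A$. A Radon measure is a non-negative Borel measure that is locally finite and inner regular with respect to compact sets. A representing Radon measure for a linear functional $L:A\to\mathbb{R}$ is a Radon measure $\nu$ on $X(A)$ such that every $\hat a$ is $\nu$-integrable and $L(a)=\int_{X(A)}\hat a\,d\nu$ for all $a\in A$. A seminorm $p$ on a real vector space $V$ is Hilbertian if $p(v)=\sqrt{\langle v,v\rangle_p}$ for a (necessarily unique) symmetric positive semidefinite bilinear form $\langle\cdot,\cdot\rangle_p$ on $V$. For Hilbertian seminorms $p,q$ on $V$ put $\mathrm{tr}(p/q):=\sup_E\sum_{e\in E}p(e)^2$, the supremum over all finite $q$-orthonormal sets $E\subseteq V$, if $\ker q\subseteq\ker p$, and $\mathrm{tr}(p/q):=\infty$ otherwise. A linear functional $\ell$ on $V$ is $q$-continuous if $|\ell(v)|\le Cq(v)$ for all $v\in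 V$, for some $C>0$. Let $A$ be generated as a unital algebra by a linear subspace $V\subseteq A$, let $q$ be a Hilbertian seminorm on $V$ such that the set $$X_q:=\{\alpha\in X(A):\alpha|_V\text{ is }q\text{-continuous}\}$$ is non-empty, and let $L:A\to\mathbb{R}$ be linear with $L(1)=1$. Let $J$ be the set of all unital subalgebras $\langle W\rangle$ of $A$ generated by a finite-dimensional subspace $W\subseteq V$. For a seminorm $p$ on $V$, a family $(\nu_S)_{S\in J}$ of Radon measures $\nu_S$ on $X(S)$ is called $p$-concentrated if for every $\varepsilon>0$ there is $\delta>0$ such that $\nu_S(\{\alpha\in X(S):|\alpha(a)|\ge1\})\le\varepsilon$ for all $S\in J$ and all $a\in V\cap S$ with $p(a)\le\delta$. **Theorem.** There exists a representing Radon measure $\nu$ for $L$ that is supported on $X_q$, in the sense that $\nu(X(A)\setminus X_q)=0$, if and only if there exist a Hilbertian seminorm $p$ on $V$ with $\mathrm{tr}(p/q)<\infty$ and, for each $S\in J$, a representing Radon measure $\nu_S$ for $L|_S$ such that the family $(\nu_S)_{S\in J}$ is $p$-concentrated. -/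

import Mathlib

open MeasureTheory
open scoped ENNReal

noncomputable section

/-- The character space `X(A)` of a real algebra `A`: all unital `ℝ`-algebra homomorphisms
`A → ℝ`. -/
abbrev CharSpace (A : Type*) [CommRing A] [Algebra ℝ A] : Type _ := A →ₐ[ℝ] ℝ

namespace CharSpace

variable {A : Type*} [CommRing A] [Algebra ℝ A]

/-- The weakest topology on `X(A)` making all evaluations `α ↦ α a` continuous. -/
instance instTopologicalSpace : TopologicalSpace (CharSpace A) :=
  TopologicalSpace.induced (fun (α : CharSpace A) (a : A) => α a) inferInstance

/-- `X(A)` carries its Borel `σ`-algebra. -/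
instance instMeasurableSpace : MeasurableSpace (CharSpace A) := borel (CharSpace A)

instance instBorelSpace : BorelSpace (CharSpace A) := ⟨rfl⟩

end CharSpace

/-- A Radon measure: a Borel measure that is locally finite and inner regular with respect to
compact sets (on all Borel sets). -/
structure IsRadonMeasure {X : Type*} [TopologicalSpace X] [MeasurableSpace X]
    (ν : Measure X) : Prop where
  locallyFinite : IsLocallyFiniteMeasure ν
  innerRegular : ν.InnerRegular

/-- `ν` is a representing Radon measure for the linear functional `L` on `A`: it is a Radon
measure on `X(A)` such that `L a = ∫ α(a) dν(α)` for all `a` (the integrals being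
convergent). -/
structure IsRepresentingRadonMeasure {A : Type*} [CommRing A] [Algebra ℝ A]
    (L : A →ₗ[ℝ] ℝ) (ν : Measure (CharSpace A)) : Prop where
  isRadon : IsRadonMeasure ν
  integrable : ∀ a : A, Integrable (fun α : CharSpace A => α a) ν
  integral_eq : ∀ a : A, L a = ∫ α : CharSpace A, α a ∂ν

/-- A seminorm is Hilbertian if it is induced by a symmetric positive semidefinite bilinear
form. -/
def Seminorm.IsHilbertian {E : Type*} [AddCommGroup E] [Module ℝ E] (p : Seminorm ℝ E) : Prop :=
  ∃ B : E →ₗ[ℝ] E →ₗ[ℝ] ℝ,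
    (∀ v w, B v w = B w v) ∧ (∀ v, 0 ≤ B v v) ∧ ∀ v, p v = Real.sqrt (B v v)

/-- The form `⟨v, w⟩_p`, recovered from `p` by polarization. For a Hilbertian seminorm `p` this
is the unique symmetric bilinear form inducing `p`. -/
def Seminorm.polarForm {E : Type*} [AddCommGroup E] [Module ℝ E] (p : Seminorm ℝ E)
    (v w : E) : ℝ :=
  (p (v + w) ^ 2 - p v ^ 2 - p w ^ 2) / 2

/-- Finite `q`-orthonormal subsets. -/
def Seminorm.IsFiniteOrthonormal {E : Type*} [AddCommGroup E] [Module ℝ E] (q : Seminorm ℝ E)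
    (s : Finset E) : Prop :=
  (∀ e ∈ s, ∀ f ∈ s, e ≠ f → q.polarForm e f = 0) ∧ ∀ e ∈ s, q e = 1

open Classical in
/-- The trace `tr(p/q) ∈ [0, ∞]` of `p` with respect to `q`: the supremum of `∑_{e ∈ s} p(e)²`
over all finite `q`-orthonormal sets `s` if `ker q ⊆ ker p`, and `∞` otherwise. -/
def Seminorm.traceRel {E : Type*} [AddCommGroup E] [Module ℝ E] (p q : Seminorm ℝ E) : ℝ≥0∞ :=
  if ∀ v, q v = 0 → p v = 0 then
    ⨆ (s : Finset E) (_ : q.IsFiniteOrthonormal s), ∑ e ∈ s, ENNReal.ofReal (p e ^ 2)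
  else ∞

/-- The index family `J`: the subalgebras `⟨W⟩` of `A` generated by the finite-dimensional
subspaces `W` of `V`. -/
def FinGenBy {A : Type*} [CommRing A] [Algebra ℝ A] (V : Submodule ℝ A) :
    Set (Subalgebra ℝ A) :=
  {S | ∃ W : Submodule ℝ A, W ≤ V ∧ FiniteDimensional ℝ W ∧ S = Algebra.adjoin ℝ (W : Set A)}

/-- The characters of `A` whose restriction to `V` is `q`-continuous. -/
def contChars {A : Type*} [CommRing A] [Algebra ℝ A] (V : Submodule ℝ A) (q : Seminorm ℝ V) :
    Set (CharSpace A) :=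
  {α | ∃ C : ℝ, 0 < C ∧ ∀ v : V, |α (v : A)| ≤ C * q v}

/-- A family of measures `ν S` on `X(S)`, `S ∈ J`, is `p`-concentrated if for every `ε > 0` there
is `δ > 0` such that `ν S {α | 1 ≤ |α a|} ≤ ε` for all `S ∈ J` and all `a ∈ V ∩ S` with
`p a ≤ δ`. -/
def IsConcentrated {A : Type*} [CommRing A] [Algebra ℝ A] (V : Submodule ℝ A)
    (p : Seminorm ℝ V) (ν : ∀ S : FinGenBy V, Measure (CharSpace S.1)) : Prop :=
  ∀ ε : ℝ, 0 < ε → ∃ δ : ℝ, 0 < δ ∧ ∀ (S : FinGenBy V) (a : V) (ha : (a : A) ∈ S.1),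
    p a ≤ δ → ν S {α : CharSpace S.1 | 1 ≤ |α ⟨a, ha⟩|} ≤ ENNReal.ofReal ε

end

/-! Sufficiency. A character restricted to a finite-dimensional subspace of `V` is a random linear
functional there. Averaging its values over random signs (`one_div_ten_le_radAvg`) turns smallness
of each evaluation in terms of `p` into a Minlos–Sazonov bound on the sum of squares of many
evaluations (`measureReal_two_le_sum_sq_le`). Applied to a `q`-orthonormal basis, it shows that `|α
v| ≤ C * q v` fails with probability at most `10 * (ε + 2 * tr(p/q) / (C ^ 2 * δ ^ 2))`, whatever
the dimension (`measureReal_not_forall_abs_le_le`). The measures are therefore uniformly tight.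

They need not be compatible with each other, so instead of a projective limit one takes a cluster
point: extend characters by zero to points of the compact space `A → EReal` and pass to the limit
along an ultrafilter (`exists_regular_limit`). Tightness puts the limit on a countable union of
compact images of sets of `q`-bounded characters (`one_sub_le_measureReal_embeddedBall`), whence it
is carried back to `X(A)`. The moments survive because `L (a ^ 2)` controls the truncation error for
`a` uniformly (`integrable_and_integral_eq_of_truncate`).

Necessity. Let `N α` be the least integer `n` with `|α v| ≤ n * q v` on `V`, and let `p v` be the
`L²` norm of `α ↦ α v / (1 + N α)`. Bessel's inequality gives trace at most `1`; Chebyshev's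
inequality on `{N ≤ n}` gives concentration, which restriction to subalgebras preserves. -/

noncomputable section

/-! ### Random signs: moments and anti-concentration -/

/-- The average of `f (± x₁ ± x₂ ± ⋯)` over all choices of signs, for a list `[x₁, x₂, …]`. -/
def radAvg {E : Type*} [AddCommGroup E] : List E → (E → ℝ) → ℝ
  | [], f => f 0
  | x :: l, f => (radAvg l (fun z => f (z + x)) + radAvg l (fun z => f (z - x))) / 2

section Rademacher

variable {E F : Type*} [AddCommGroup E] [AddCommGroup F]

theorem radAvg_mono (l : List E) {f g : E → ℝ} (h : ∀ z, f z ≤ g z) :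
    radAvg l f ≤ radAvg l g := by
  induction l generalizing f g with
  | nil => exact h 0
  | cons x l ih =>
    have h₁ := ih (f := fun z => f (z + x)) (g := fun z => g (z + x)) fun z => h _
    have h₂ := ih (f := fun z => f (z - x)) (g := fun z => g (z - x)) fun z => h _
    simp only [radAvg]
    linarith

theorem radAvg_add (l : List E) (f g : E → ℝ) :
    radAvg l (fun z => f z + g z) = radAvg l f + radAvg l g := by
  induction l generalizing f g with
  | nil => rfl
  | cons x l ih => simp only [radAvg, ih]; ring

theorem radAvg_const_mul (l : List E) (c : ℝ) (f : E → ℝ) :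
    radAvg l (fun z => c * f z) = c * radAvg l f := by
  induction l generalizing f with
  | nil => rfl
  | cons x l ih => simp only [radAvg, ih]; ring

theorem radAvg_const (l : List E) (c : ℝ) : radAvg l (fun _ => c) = c := by
  induction l with
  | nil => rfl
  | cons x l ih => simp only [radAvg, ih]; ring

theorem radAvg_map (l : List E) (φ : E →+ F) (f : F → ℝ) :
    radAvg (l.map φ) f = radAvg l (fun z => f (φ z)) := by
  induction l generalizing f with
  | nil => simp [radAvg]
  | cons x l ih => simp only [radAvg, List.map_cons, ih, map_add, map_sub]

/-- The parallelogram law removes the cross terms one vector at a time; the shift `y` is what lets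
the induction run. -/
theorem radAvg_quadratic [Module ℝ E] (B : E →ₗ[ℝ] E →ₗ[ℝ] ℝ) (l : List E) (y : E) :
    radAvg l (fun z => B (z + y) (z + y)) = B y y + (l.map fun x => B x x).sum := by
  induction l generalizing y with
  | nil => simp [radAvg]
  | cons x l ih =>
    have h₁ : (fun z => B (z + x + y) (z + x + y)) =
        fun z => B (z + (x + y)) (z + (x + y)) := by simp only [add_assoc]
    have h₂ : (fun z => B (z - x + y) (z - x + y)) =
        fun z => B (z + (y - x)) (z + (y - x)) := by
      funext z; rw [show z - x + y = z + (y - x) by abel]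
    simp only [radAvg, h₁, h₂, ih, List.map_cons, List.sum_cons]
    simp only [map_add, map_sub, LinearMap.add_apply, LinearMap.sub_apply]
    ring

theorem radAvg_sq (l : List ℝ) :
    radAvg l (fun z => z ^ 2) = (l.map fun x => x ^ 2).sum := by
  simpa [pow_two] using radAvg_quadratic (LinearMap.mul ℝ ℝ) l 0

/-- The number `m` is the fourth moment of the sign sum, bounded by three times the squared second
moment (Khinchine). Odd moments vanish by symmetry, so only even powers of the shift `y` occur. -/
theorem exists_radAvg_pow_four (l : List ℝ) :
    ∃ m ≤ 3 * (l.map fun x => x ^ 2).sum ^ 2, ∀ y : ℝ,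
      radAvg l (fun z => (z + y) ^ 4) = y ^ 4 + 6 * y ^ 2 * (l.map fun x => x ^ 2).sum + m := by
  induction l with
  | nil => exact ⟨0, by simp, fun y => by simp [radAvg]⟩
  | cons x l ih =>
    obtain ⟨m, hm, h⟩ := ih
    set T := (l.map fun x => x ^ 2).sum with hT
    refine ⟨x ^ 4 + 6 * x ^ 2 * T + m, ?_, fun y => ?_⟩
    · simp only [List.map_cons, List.sum_cons, ← hT]
      nlinarith [sq_nonneg (x ^ 2)]
    · have h₁ : (fun z => (z + x + y) ^ 4) = fun z : ℝ => (z + (x + y)) ^ 4 := by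
        simp only [add_assoc]
      have h₂ : (fun z => (z - x + y) ^ 4) = fun z : ℝ => (z + (y - x)) ^ 4 := by
        funext z; ring
      simp only [radAvg, h₁, h₂, h, List.map_cons, List.sum_cons, ← hT]
      ring

/-- Paley–Zygmund inequality for Rademacher sums. -/
theorem one_div_ten_le_radAvg (l : List ℝ) (h : 2 ≤ (l.map fun x => x ^ 2).sum) :
    1 / 10 ≤ radAvg l (fun z => if 1 ≤ |z| then 1 else 0) := by
  obtain ⟨m, hm, hl⟩ := exists_radAvg_pow_four l
  have h₄ := hl 0
  have h₂ := radAvg_sq l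
  set T := (l.map fun x => x ^ 2).sum with hT
  simp only [add_zero] at h₄
  -- The left side is `-(z ^ 2 - T / 2) * (z ^ 2 - 21 * T / 2)`: it is at most `25 * T ^ 2`
  -- everywhere and nonpositive for `z ^ 2 < 1 ≤ T / 2`. Its average is at least `(11 - 3 - 21 / 4)
  -- * T ^ 2`, which exceeds `25 * T ^ 2 / 10`.
  have key : ∀ z : ℝ, (11 * T) * z ^ 2 + ((-1) * z ^ 4 + -(21 / 4) * T ^ 2) ≤
      (25 * T ^ 2) * (if 1 ≤ |z| then 1 else 0) := by
    intro z
    split_ifs with hz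
    · nlinarith [sq_nonneg (z ^ 2 - 11 / 2 * T)]
    · have hz' : z ^ 2 < 1 := by
        rw [← sq_abs]; nlinarith [abs_nonneg z]
      nlinarith [mul_nonneg (by linarith : 0 ≤ T / 2 - z ^ 2)
        (by linarith : (0 : ℝ) ≤ 21 * T / 2 - z ^ 2)]
  have := radAvg_mono l key
  rw [radAvg_add, radAvg_add, radAvg_const_mul l (11 * T), radAvg_const_mul l (-1),
    radAvg_const_mul l (25 * T ^ 2), radAvg_const, h₂, h₄] at this
  have hT2 : 0 < T ^ 2 := by positivity
  by_contra! hc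
  nlinarith [mul_lt_mul_of_pos_left hc (by positivity : 0 < 25 * T ^ 2)]

theorem integrable_radAvg {Ω : Type*} [MeasurableSpace Ω] {P : Measure Ω} (l : List E)
    {f : Ω → E → ℝ} (hf : ∀ z, Integrable (fun ω => f ω z) P) :
    Integrable (fun ω => radAvg l (f ω)) P := by
  induction l generalizing f with
  | nil => exact hf 0
  | cons x l ih =>
    exact ((ih (f := fun ω z => f ω (z + x)) fun z => hf _).add
      (ih (f := fun ω z => f ω (z - x)) fun z => hf _)).div_const 2

theorem integral_radAvg {Ω : Type*} [MeasurableSpace Ω] {P : Measure Ω} (l : List E)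
    {f : Ω → E → ℝ} (hf : ∀ z, Integrable (fun ω => f ω z) P) :
    ∫ ω, radAvg l (f ω) ∂P = radAvg l (fun z => ∫ ω, f ω z ∂P) := by
  induction l generalizing f with
  | nil => rfl
  | cons x l ih =>
    simp only [radAvg]
    rw [integral_div, integral_add (integrable_radAvg l fun z => hf _)
      (integrable_radAvg l fun z => hf _), ih fun z => hf _, ih fun z => hf _]

end Rademacher

/-! ### The Minlos–Sazonov inequality -/

section Minlos

variable {Ω E : Type*} [MeasurableSpace Ω] [AddCommGroup E] [Module ℝ E]

theorem measurable_list_sum_sq {X : Ω → E →ₗ[ℝ] ℝ} (hX : ∀ v, Measurable fun ω => X ω v)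
    (l : List E) : Measurable fun ω => (l.map fun x => X ω x ^ 2).sum := by
  induction l with
  | nil => simp
  | cons x l ih => simp only [List.map_cons, List.sum_cons]; exact ((hX x).pow_const 2).add ih

/-- A quantitative Minlos–Sazonov inequality. -/
theorem measureReal_two_le_sum_sq_le {P : Measure Ω} [IsProbabilityMeasure P]
    {X : Ω → E →ₗ[ℝ] ℝ} (hX : ∀ v, Measurable fun ω => X ω v)
    {p : Seminorm ℝ E} (hp : p.IsHilbertian) {δ ε : ℝ} (hδ : 0 < δ) (hε : 0 ≤ ε)
    (h : ∀ z, p z ≤ δ → P.real {ω | 1 ≤ |X ω z|} ≤ ε) (l : List E) :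
    P.real {ω | 2 ≤ (l.map fun x => X ω x ^ 2).sum} ≤
      10 * (ε + (l.map fun x => p x ^ 2).sum / δ ^ 2) := by
  obtain ⟨B, -, hB0, hB⟩ := hp
  have hB2 : ∀ v, p v ^ 2 = B v v := fun v => by rw [hB, Real.sq_sqrt (hB0 v)]
  have hset : ∀ z, MeasurableSet {ω | 1 ≤ |X ω z|} := fun z =>
    measurableSet_le measurable_const (hX z).abs
  set f : Ω → E → ℝ := fun ω z => if 1 ≤ |X ω z| then 1 else 0 with hf
  have hfi : ∀ z, (fun ω => f ω z) = {ω | 1 ≤ |X ω z|}.indicator 1 := by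
    intro z; funext ω; simp [hf, Set.indicator]
  have hint : ∀ z, Integrable (fun ω => f ω z) P := by
    intro z
    rw [hfi]
    exact (integrable_const (1 : ℝ)).indicator (hset z)
  -- For fixed `ω`, a large sum of squares forces at least a tenth of the signed sums to have
  -- absolute value at least `1`. Integrating and exchanging the two averages leaves probabilities
  -- of single evaluations.
  have hlow : ∀ ω, {ω | 2 ≤ (l.map fun x => X ω x ^ 2).sum}.indicator (1 : Ω → ℝ) ω ≤
      10 * radAvg l (f ω) := by
    intro ω
    have hnn : 0 ≤ radAvg l (f ω) := by
      rw [← radAvg_const l 0]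
      refine radAvg_mono l fun z => ?_
      simp only [hf]; split_ifs <;> norm_num
    by_cases hω : 2 ≤ (l.map fun x => X ω x ^ 2).sum
    · have := one_div_ten_le_radAvg (l.map (X ω)) (by simpa [Function.comp_def] using hω)
      have h2 := radAvg_map l (X ω).toAddMonoidHom (fun z : ℝ => if 1 ≤ |z| then 1 else 0)
      simp only [LinearMap.toAddMonoidHom_coe] at h2
      rw [h2] at this
      rw [Set.indicator_of_mem (by exact hω)]
      change 1 / 10 ≤ radAvg l (f ω) at this
      simp only [Pi.one_apply]
      linarith
    · rw [Set.indicator_of_notMem (by exact hω)]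
      linarith
  have hmeas : MeasurableSet {ω | 2 ≤ (l.map fun x => X ω x ^ 2).sum} :=
    measurableSet_le measurable_const (measurable_list_sum_sq hX l)
  -- Where `p z > δ` the trivial bound `1` is absorbed by `p z ^ 2 / δ ^ 2`. The resulting majorant
  -- is quadratic in `z`, so its sign average is computed exactly.
  have hpt : ∀ z, P.real {ω | 1 ≤ |X ω z|} ≤ ε + (1 / δ ^ 2) * B z z := by
    intro z
    rcases le_or_gt (p z) δ with hz | hz
    · have := h z hz
      have h2 : 0 ≤ (1 / δ ^ 2) * B z z := mul_nonneg (by positivity) (hB0 z)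
      linarith
    · have h1 : P.real {ω | 1 ≤ |X ω z|} ≤ 1 := measureReal_le_one
      have h2 : 1 ≤ (1 / δ ^ 2) * B z z := by
        rw [← hB2, one_div, ← div_eq_inv_mul, one_le_div (by positivity)]
        gcongr
      linarith
  calc P.real {ω | 2 ≤ (l.map fun x => X ω x ^ 2).sum}
      = ∫ ω, {ω | 2 ≤ (l.map fun x => X ω x ^ 2).sum}.indicator (1 : Ω → ℝ) ω ∂P :=
        (integral_indicator_one hmeas).symm
    _ ≤ ∫ ω, 10 * radAvg l (f ω) ∂P :=
        integral_mono ((integrable_const (1 : ℝ)).indicator hmeas)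
          ((integrable_radAvg l hint).const_mul 10) hlow
    _ = 10 * radAvg l (fun z => P.real {ω | 1 ≤ |X ω z|}) := by
        rw [integral_const_mul, integral_radAvg l hint]
        congr 2
        funext z
        rw [hfi, integral_indicator_one (hset z)]
    _ ≤ 10 * (ε + (1 / δ ^ 2) * (l.map fun x => B x x).sum) := by
        have h0 := radAvg_quadratic B l 0
        simp only [add_zero, map_zero, zero_add] at h0
        refine mul_le_mul_of_nonneg_left ((radAvg_mono l hpt).trans_eq ?_) (by norm_num)
        rw [radAvg_add, radAvg_const, radAvg_const_mul, h0]
    _ = _ := by simp only [hB2]; ring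

end Minlos

/-! ### Hilbertian seminorms and the relative trace -/

section Trace

variable {E : Type*} [AddCommGroup E] [Module ℝ E]

theorem Seminorm.polarForm_eq {q : Seminorm ℝ E} {B : E →ₗ[ℝ] E →ₗ[ℝ] ℝ}
    (hs : ∀ v w, B v w = B w v) (h0 : ∀ v, 0 ≤ B v v) (hB : ∀ v, q v = Real.sqrt (B v v))
    (v w : E) : q.polarForm v w = B v w := by
  have hq : ∀ v, q v ^ 2 = B v v := fun v => by rw [hB, Real.sq_sqrt (h0 v)]
  simp only [Seminorm.polarForm, hq, map_add, LinearMap.add_apply, hs w v]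
  ring

theorem Seminorm.IsHilbertian.comp {F : Type*} [AddCommGroup F] [Module ℝ F]
    {q : Seminorm ℝ E} (hq : q.IsHilbertian) (f : F →ₗ[ℝ] E) : (q.comp f).IsHilbertian := by
  obtain ⟨B, hs, h0, hB⟩ := hq
  exact ⟨B.compl₁₂ f f, fun v w => hs _ _, fun v => h0 _, fun v => hB _⟩

theorem Seminorm.sum_sq_le_of_traceRel_lt_top {p q : Seminorm ℝ E} (h : p.traceRel q < ∞)
    {s : Finset E} (hs : q.IsFiniteOrthonormal s) :
    ∑ e ∈ s, p e ^ 2 ≤ (p.traceRel q).toReal := by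
  have hker : ∀ v, q v = 0 → p v = 0 := by
    by_contra hc
    simp [Seminorm.traceRel, hc] at h
  have h1 : ∑ e ∈ s, ENNReal.ofReal (p e ^ 2) ≤ p.traceRel q := by
    rw [Seminorm.traceRel, if_pos hker]
    exact le_iSup₂ (f := fun (s : Finset E) (_ : q.IsFiniteOrthonormal s) =>
      ∑ e ∈ s, ENNReal.ofReal (p e ^ 2)) s hs
  rw [← ENNReal.ofReal_sum_of_nonneg fun e _ => by positivity] at h1
  exact (ENNReal.ofReal_le_iff_le_toReal h.ne).mp h1

theorem Seminorm.eq_zero_of_traceRel_lt_top {p q : Seminorm ℝ E} (h : p.traceRel q < ∞)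
    {v : E} (hv : q v = 0) : p v = 0 := by
  by_contra hc
  have : ¬ ∀ v, q v = 0 → p v = 0 := fun hk => hc (hk v hv)
  simp [Seminorm.traceRel, this] at h

end Trace

/-! ### Dimension-free bounds for random functionals -/

section Minlos

variable {Ω E : Type*} [MeasurableSpace Ω] [AddCommGroup E] [Module ℝ E]

/-- Every multiple `n • v` also has seminorm zero, so concentration applies to it with every `ε`,
and `|X v| ≥ 1 / n` has probability zero for each `n ≥ 1`. -/
theorem ae_eq_zero_of_seminorm_eq_zero {P : Measure Ω} [IsProbabilityMeasure P]
    {X : Ω → E →ₗ[ℝ] ℝ} {p : Seminorm ℝ E}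
    (h : ∀ ε : ℝ, 0 < ε → ∃ δ : ℝ, 0 < δ ∧ ∀ z, p z ≤ δ → P.real {ω | 1 ≤ |X ω z|} ≤ ε)
    {v : E} (hv : p v = 0) : ∀ᵐ ω ∂P, X ω v = 0 := by
  have hn : ∀ n : ℕ, P {ω | 1 ≤ |X ω ((n : ℝ) • v)|} = 0 := by
    intro n
    rw [← measureReal_eq_zero_iff]
    refine le_antisymm (le_of_forall_pos_le_add fun ε hε => ?_) measureReal_nonneg
    obtain ⟨δ, hδ, hz⟩ := h ε hε
    rw [zero_add]
    exact hz _ (by rw [map_smul_eq_mul, hv, mul_zero]; exact hδ.le)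
  have hsub : {ω | X ω v ≠ 0} ⊆ ⋃ n : ℕ, {ω | 1 ≤ |X ω ((n : ℝ) • v)|} := by
    intro ω hω
    have hpos : 0 < |X ω v| := abs_pos.mpr hω
    obtain ⟨n, hn⟩ := exists_nat_ge (1 / |X ω v|)
    refine Set.mem_iUnion.mpr ⟨n, ?_⟩
    change 1 ≤ |X ω ((n : ℝ) • v)|
    rw [map_smul, smul_eq_mul, abs_mul, Nat.abs_cast]
    rwa [div_le_iff₀ hpos] at hn
  exact measure_mono_null hsub (measure_iUnion_null hn)

/-- In `q`-orthonormal coordinates, Cauchy–Schwarz bounds `|X v|` by `q v` times the root of `∑ X (e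
i) ^ 2`, and the Minlos inequality controls that sum. Directions in the kernel of `q` lie in that of
`p`, hence are almost surely killed by `X`. -/
theorem measureReal_not_forall_abs_le_le [FiniteDimensional ℝ E] {P : Measure Ω}
    [IsProbabilityMeasure P] {X : Ω → E →ₗ[ℝ] ℝ} (hX : ∀ v, Measurable fun ω => X ω v)
    {p q : Seminorm ℝ E} (hp : p.IsHilbertian) (hq : q.IsHilbertian) {T : ℝ}
    (hT : ∀ s : Finset E, q.IsFiniteOrthonormal s → ∑ e ∈ s, p e ^ 2 ≤ T)
    (hker : ∀ v, q v = 0 → p v = 0)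
    (hconc : ∀ ε : ℝ, 0 < ε → ∃ δ : ℝ, 0 < δ ∧ ∀ z, p z ≤ δ → P.real {ω | 1 ≤ |X ω z|} ≤ ε)
    {δ ε : ℝ} (hδ : 0 < δ) (hε : 0 ≤ ε) (h : ∀ z, p z ≤ δ → P.real {ω | 1 ≤ |X ω z|} ≤ ε)
    {C : ℝ} (hC : 0 < C) :
    P.real {ω | ¬ ∀ v, |X ω v| ≤ C * q v} ≤ 10 * (ε + 2 * T / (C ^ 2 * δ ^ 2)) := by
  classical
  obtain ⟨B, hs, h0, hB⟩ := hq
  have hq2 : ∀ v, q v ^ 2 = B v v := fun v => by rw [hB, Real.sq_sqrt (h0 v)]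
  obtain ⟨b, hb⟩ := LinearMap.BilinForm.exists_orthogonal_basis (B := B) ⟨fun v w => hs v w⟩
  have hb' : ∀ i j, i ≠ j → B (b i) (b j) = 0 := fun i j hij => hb hij
  -- The form may be degenerate: only basis vectors outside its kernel can be normalised.
  set I := Finset.univ.filter fun i => B (b i) (b i) ≠ 0 with hI
  set r := fun i => Real.sqrt (B (b i) (b i)) with hr
  have hr2 : ∀ i, r i ^ 2 = B (b i) (b i) := fun i => Real.sq_sqrt (h0 _)
  have hr0 : ∀ i ∈ I, r i ≠ 0 := by
    intro i hi h
    exact (Finset.mem_filter.mp hi).2 (by rw [← hr2, h]; ring)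
  set e := fun i => (r i)⁻¹ • b i with he
  have hee : ∀ i ∈ I, B (e i) (e i) = 1 := by
    intro i hi
    have := hr0 i hi
    simp only [he, map_smul, LinearMap.smul_apply, smul_eq_mul, ← hr2]
    field_simp
  have heij : ∀ i j, i ≠ j → B (e i) (e j) = 0 := by
    intro i j hij
    simp [he, hb' i j hij]
  have hinj : Set.InjOn e I := by
    intro i hi j hj hij
    by_contra hne
    have := heij i j hne
    rw [← hij, hee i hi] at this
    exact one_ne_zero this
  have horth : q.IsFiniteOrthonormal (I.image e) := by
    constructor
    · intro x hx y hy hxy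
      obtain ⟨i, hi, rfl⟩ := Finset.mem_image.mp hx
      obtain ⟨j, hj, rfl⟩ := Finset.mem_image.mp hy
      rw [Seminorm.polarForm_eq hs h0 hB]
      exact heij i j fun hij => hxy (hij ▸ rfl)
    · intro x hx
      obtain ⟨i, hi, rfl⟩ := Finset.mem_image.mp hx
      rw [hB, hee i hi, Real.sqrt_one]
  have hsum : ∑ i ∈ I, p (e i) ^ 2 ≤ T := by
    rw [← Finset.sum_image (f := fun x => p x ^ 2) hinj]
    exact hT _ horth
  -- This scaling turns the event `∑ X (e i) ^ 2 ≥ C ^ 2` into the threshold `2` of the Minlos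
  -- inequality.
  set c := Real.sqrt 2 / C with hc
  have hc2 : c ^ 2 = 2 / C ^ 2 := by rw [hc, div_pow, Real.sq_sqrt (by norm_num)]
  set l := I.toList.map fun i => c • e i with hl
  have hXl : ∀ ω, (l.map fun x => X ω x ^ 2).sum = 2 / C ^ 2 * ∑ i ∈ I, X ω (e i) ^ 2 := by
    intro ω
    rw [hl, List.map_map, Finset.mul_sum, ← Finset.sum_map_toList]
    simp [Function.comp_def, mul_pow, hc2]
  have hpl : (l.map fun x => p x ^ 2).sum = 2 / C ^ 2 * ∑ i ∈ I, p (e i) ^ 2 := by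
    rw [hl, List.map_map, Finset.mul_sum, ← Finset.sum_map_toList]
    simp [Function.comp_def, map_smul_eq_mul, mul_pow, hc2]
  have hnull : ∀ᵐ ω ∂P, ∀ i, i ∉ I → X ω (b i) = 0 := by
    rw [ae_all_iff]
    intro i
    by_cases hi : i ∈ I
    · exact Filter.Eventually.of_forall fun ω h => absurd hi h
    · have : B (b i) (b i) = 0 := by simpa [hI] using hi
      filter_upwards [ae_eq_zero_of_seminorm_eq_zero hconc
        (hker (b i) (by rw [hB, this, Real.sqrt_zero]))] with ω hω _ using hω
  have hle : P {ω | ¬ ∀ v, |X ω v| ≤ C * q v} ≤ P {ω | 2 ≤ (l.map fun x => X ω x ^ 2).sum} := by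
    refine measure_mono_ae ?_
    filter_upwards [hnull] with ω hω hbad
    by_contra hlt
    refine hbad fun v => ?_
    have hlt' : ∑ i ∈ I, X ω (e i) ^ 2 < C ^ 2 := by
      have : 2 / C ^ 2 * ∑ i ∈ I, X ω (e i) ^ 2 < 2 := by
        rw [← hXl]; exact not_le.mp hlt
      rw [div_mul_eq_mul_div, div_lt_iff₀ (by positivity)] at this
      linarith
    have hv := b.sum_repr v
    have hXv : X ω v = ∑ i ∈ I, (b.repr v i * r i) * X ω (e i) := by
      conv_lhs => rw [← hv]
      rw [map_sum, ← Finset.sum_subset (Finset.subset_univ I)]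
      · refine Finset.sum_congr rfl fun i hi => ?_
        have := hr0 i hi
        simp only [he, map_smul, smul_eq_mul]
        field_simp
      · intro i _ hi
        rw [map_smul, hω i hi, smul_zero]
    have hqv : q v ^ 2 = ∑ i ∈ I, (b.repr v i * r i) ^ 2 := by
      rw [hq2]
      conv_lhs => rw [← hv]
      simp only [map_sum, LinearMap.sum_apply, map_smul, LinearMap.smul_apply, smul_eq_mul]
      rw [← Finset.sum_subset (Finset.subset_univ I)]
      · refine Finset.sum_congr rfl fun i hi => ?_
        rw [Finset.sum_eq_single i]
        · rw [mul_pow, hr2]; ring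
        · intro j _ hj; rw [hb' j i hj]; ring
        · simp
      · intro i _ hi
        have : B (b i) (b i) = 0 := by simpa [hI] using hi
        refine mul_eq_zero_of_right _ (Finset.sum_eq_zero fun j _ => ?_)
        rcases eq_or_ne j i with rfl | hji
        · rw [this]; ring
        · rw [hb' j i hji]; ring
    refine abs_le_of_sq_le_sq ?_ (mul_nonneg hC.le (apply_nonneg q v))
    calc X ω v ^ 2 ≤ (∑ i ∈ I, (b.repr v i * r i) ^ 2) * ∑ i ∈ I, X ω (e i) ^ 2 := by
          rw [hXv]; exact Finset.sum_mul_sq_le_sq_mul_sq _ _ _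
      _ ≤ q v ^ 2 * C ^ 2 := by
          rw [← hqv]; exact mul_le_mul_of_nonneg_left hlt'.le (sq_nonneg _)
      _ = (C * q v) ^ 2 := by ring
  calc P.real {ω | ¬ ∀ v, |X ω v| ≤ C * q v}
      ≤ P.real {ω | 2 ≤ (l.map fun x => X ω x ^ 2).sum} :=
        ENNReal.toReal_mono (measure_ne_top _ _) hle
    _ ≤ 10 * (ε + (l.map fun x => p x ^ 2).sum / δ ^ 2) :=
        measureReal_two_le_sum_sq_le hX hp hδ hε h l
    _ ≤ 10 * (ε + 2 / C ^ 2 * T / δ ^ 2) := by rw [hpl]; gcongr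
    _ = _ := by field_simp

end Minlos

/-! ### Topology of character spaces -/

open Filter Topology CompactlySupported

namespace CharSpace

variable {A : Type*} [CommRing A] [Algebra ℝ A]

theorem isEmbedding_coe : IsEmbedding (fun (α : CharSpace A) (a : A) => α a) :=
  ⟨⟨rfl⟩, DFunLike.coe_injective⟩

theorem continuous_eval (a : A) : Continuous fun α : CharSpace A => α a :=
  (continuous_apply a).comp isEmbedding_coe.continuous

theorem continuous_iff {X : Type*} [TopologicalSpace X] {f : X → CharSpace A} :
    Continuous f ↔ ∀ a, Continuous fun x => f x a := by
  rw [isEmbedding_coe.continuous_iff, continuous_pi_iff]; rfl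

instance instT2Space : T2Space (CharSpace A) := isEmbedding_coe.t2Space

theorem isClosedEmbedding_coe : IsClosedEmbedding (fun (α : CharSpace A) (a : A) => α a) := by
  refine ⟨isEmbedding_coe, ?_⟩
  have : Set.range (fun (α : CharSpace A) (a : A) => α a) =
      {f | f 1 = 1} ∩ ({f | ∀ a b, f (a * b) = f a * f b} ∩
        ({f | ∀ a b, f (a + b) = f a + f b} ∩ {f | ∀ (c : ℝ) a, f (c • a) = c * f a})) := by
    ext f
    constructor
    · rintro ⟨α, rfl⟩
      exact ⟨map_one α, map_mul α, map_add α, fun c a => map_smul α c a⟩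
    · rintro ⟨h1, hmul, hadd, hsmul⟩
      exact ⟨AlgHom.ofLinearMap ⟨⟨f, hadd⟩, hsmul⟩ h1 hmul, rfl⟩
  rw [this]
  refine (isClosed_eq (continuous_apply _) continuous_const).inter (.inter ?_ (.inter ?_ ?_))
  · simp only [Set.ofPred_forall]
    exact isClosed_iInter fun a => isClosed_iInter fun b =>
      isClosed_eq (continuous_apply _) ((continuous_apply a).mul (continuous_apply b))
  · simp only [Set.ofPred_forall]
    exact isClosed_iInter fun a => isClosed_iInter fun b =>
      isClosed_eq (continuous_apply _) ((continuous_apply a).add (continuous_apply b))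
  · simp only [Set.ofPred_forall]
    exact isClosed_iInter fun a => isClosed_iInter fun b =>
      isClosed_eq (continuous_apply _) (continuous_const.mul (continuous_apply _))

theorem isClosed_setOf_abs_le {κ : Type*} (u : κ → A) (c : κ → ℝ) :
    IsClosed {α : CharSpace A | ∀ k, |α (u k)| ≤ c k} := by
  simp only [Set.ofPred_forall]
  exact isClosed_iInter fun k => isClosed_le (continuous_eval (u k)).abs continuous_const

/-- The characters that are bounded on each element of a generating family form a compact set. -/
theorem isCompact_setOf_abs_le {κ : Type*} {u : κ → A}
    (hu : Algebra.adjoin ℝ (Set.range u) = ⊤) (c : κ → ℝ) :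
    IsCompact {α : CharSpace A | ∀ k, |α (u k)| ≤ c k} := by
  -- Bounds on generators propagate through sums and products to every element, which puts the set
  -- inside a product of compact intervals.
  have hM : ∀ a : A, ∃ M : ℝ, ∀ α : CharSpace A, (∀ k, |α (u k)| ≤ c k) → |α a| ≤ M := by
    intro a
    have ha : a ∈ Algebra.adjoin ℝ (Set.range u) := hu ▸ Algebra.mem_top
    induction ha using Algebra.adjoin_induction with
    | mem x hx =>
      obtain ⟨k, rfl⟩ := hx
      exact ⟨c k, fun α h => h k⟩
    | algebraMap r => exact ⟨|r|, fun α _ => by simp⟩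
    | add x y _ _ hx hy =>
      obtain ⟨M, hM⟩ := hx
      obtain ⟨N, hN⟩ := hy
      refine ⟨M + N, fun α h => ?_⟩
      rw [map_add]
      exact (abs_add_le _ _).trans (add_le_add (hM α h) (hN α h))
    | mul x y _ _ hx hy =>
      obtain ⟨M, hM⟩ := hx
      obtain ⟨N, hN⟩ := hy
      refine ⟨M * N, fun α h => ?_⟩
      rw [map_mul, abs_mul]
      exact mul_le_mul (hM α h) (hN α h) (abs_nonneg _) ((abs_nonneg _).trans (hM α h))
  choose M hM using hM
  have hcpt : IsCompact (Set.univ.pi fun a : A => Set.Icc (-M a) (M a)) :=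
    isCompact_univ_pi fun a => isCompact_Icc
  refine (isClosedEmbedding_coe.isCompact_preimage hcpt).of_isClosed_subset
    (isClosed_setOf_abs_le u c) fun α hα a _ => abs_le.mp (hM a α hα)

/-- Restriction of characters to a subalgebra. -/
def restrict (S : Subalgebra ℝ A) (α : CharSpace A) : CharSpace S := α.comp S.val

theorem continuous_restrict (S : Subalgebra ℝ A) : Continuous (restrict S) :=
  continuous_iff.mpr fun a => continuous_eval (a : A)

open Classical in
/-- The embedding of the characters of a subalgebra `S ⊆ A` into the compact space of all
functions `A → [-∞, ∞]`, by extension by zero. -/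
def extendZero (S : Subalgebra ℝ A) (α : CharSpace S) (a : A) : EReal :=
  if h : a ∈ S then ((α ⟨a, h⟩ : ℝ) : EReal) else 0

theorem extendZero_of_mem (S : Subalgebra ℝ A) (α : CharSpace S) {a : A} (h : a ∈ S) :
    extendZero S α a = ((α ⟨a, h⟩ : ℝ) : EReal) := by simp [extendZero, h]

theorem continuous_extendZero (S : Subalgebra ℝ A) : Continuous (extendZero S) := by
  refine continuous_pi fun a => ?_
  by_cases h : a ∈ S
  · simp only [extendZero_of_mem _ _ h]
    exact continuous_coe_real_ereal.comp (continuous_eval _)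
  · simp only [extendZero, h, dite_false]
    exact continuous_const

/-- The embedding of the character space into the compact space `A → [-∞, ∞]`. -/
def toEReal (α : CharSpace A) (a : A) : EReal := ((α a : ℝ) : EReal)

theorem continuous_toEReal : Continuous (toEReal (A := A)) :=
  continuous_pi fun a => continuous_coe_real_ereal.comp (continuous_eval a)

theorem toEReal_injective : Function.Injective (toEReal (A := A)) := by
  intro α β h
  ext a
  exact EReal.coe_injective (congrFun h a)

end CharSpace

/-! ### Limits of probability measures on a compact space -/

/-- For each `f` the integrals stay in `[-‖f‖, ‖f‖]` and so converge along the ultrafilter. The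
limit is a positive linear functional of `f`, to which Riesz–Markov applies. -/
theorem exists_regular_limit {ι Y : Type*} (l : Ultrafilter ι) [TopologicalSpace Y]
    [CompactSpace Y] [T2Space Y] [MeasurableSpace Y] [BorelSpace Y]
    (P : ι → Measure Y) [∀ i, IsProbabilityMeasure (P i)] :
    ∃ μ : Measure Y, IsProbabilityMeasure μ ∧ μ.Regular ∧
      ∀ f : C(Y, ℝ), Tendsto (fun i => ∫ y, f y ∂P i) l (𝓝 (∫ y, f y ∂μ)) := by
  have hint : ∀ (f : C(Y, ℝ)) i, Integrable f (P i) := fun f i =>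
    f.continuous.integrable_of_hasCompactSupport (HasCompactSupport.of_compactSpace _)
  have hlim : ∀ f : C(Y, ℝ), ∃ r, Tendsto (fun i => ∫ y, f y ∂P i) l (𝓝 r) := by
    intro f
    have hK : IsCompact (Set.Icc (-‖f‖) ‖f‖) := isCompact_Icc
    obtain ⟨r, -, hr⟩ := hK.ultrafilter_le_nhds (l.map fun i => ∫ y, f y ∂P i) (by
      refine tendsto_principal.mpr (Eventually.of_forall fun i => ?_)
      rw [Set.mem_Icc, ← abs_le, ← Real.norm_eq_abs]
      refine (norm_integral_le_of_norm_le_const (C := ‖f‖)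
        (Eventually.of_forall fun y => f.norm_coe_le_norm y)).trans ?_
      simp)
    exact ⟨r, hr⟩
  choose Λ hΛ using hlim
  let e : C_c(Y, ℝ) → C(Y, ℝ) := fun f => f.toContinuousMap
  let Φ : C_c(Y, ℝ) →ₚ[ℝ] ℝ :=
  { toFun f := Λ (e f)
    map_add' f g := by
      refine tendsto_nhds_unique (hΛ _) (((hΛ (e f)).add (hΛ (e g))).congr fun i => ?_)
      exact (integral_add (hint _ i) (hint _ i)).symm
    map_smul' c f := by
      refine tendsto_nhds_unique (hΛ _) (((hΛ (e f)).const_smul c).congr fun i => ?_)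
      exact (integral_smul c _).symm
    monotone' f g hfg := by
      refine le_of_tendsto_of_tendsto' (hΛ _) (hΛ _) fun i => ?_
      exact integral_mono (hint _ i) (hint _ i) hfg }
  have hμ : ∀ f : C(Y, ℝ), Tendsto (fun i => ∫ y, f y ∂P i) l
      (𝓝 (∫ y, f y ∂(RealRMK.rieszMeasure Φ))) := by
    intro f
    have := RealRMK.integral_rieszMeasure Φ ⟨f, HasCompactSupport.of_compactSpace _⟩
    change ∫ y, f y ∂_ = Λ _ at this
    rw [this]
    exact hΛ f
  refine ⟨RealRMK.rieszMeasure Φ, ⟨?_⟩, inferInstance, hμ⟩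
  have h1 := tendsto_nhds_unique (hμ 1) ((tendsto_const_nhds (x := (1 : ℝ))).congr fun i => by simp)
  simp only [ContinuousMap.one_apply, integral_const, smul_eq_mul, mul_one, measureReal_def] at h1
  rwa [ENNReal.toReal_eq_one_iff] at h1

/-! ### Truncation and passage to the limit in moments -/

section Truncation

/-- Truncation of a real number to `[-n, n]`. -/
def truncate (n : ℕ) (x : ℝ) : ℝ := max (-n) (min n x)

theorem continuous_truncate (n : ℕ) : Continuous (truncate n) :=
  continuous_const.max (continuous_const.min continuous_id)

theorem truncate_eq_self {n : ℕ} {x : ℝ} (h : |x| ≤ n) : truncate n x = x := by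
  rw [truncate, min_eq_right (abs_le.mp h).2, max_eq_right (abs_le.mp h).1]

theorem abs_truncate_le_abs (n : ℕ) (x : ℝ) : |truncate n x| ≤ |x| := by
  have hn : (0 : ℝ) ≤ n := Nat.cast_nonneg n
  simp only [truncate]
  rcases abs_cases x with h | h <;> rcases max_cases (-(n : ℝ)) (min n x) with h' | h' <;>
    rcases min_cases (n : ℝ) x with h'' | h'' <;> rw [abs_le] <;> constructor <;> linarith

theorem abs_truncate_le (n : ℕ) (x : ℝ) : |truncate n x| ≤ n := by
  have hn : (0 : ℝ) ≤ n := Nat.cast_nonneg n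
  rw [abs_le]
  exact ⟨le_max_left _ _, max_le (by linarith) (min_le_left _ _)⟩

theorem abs_truncate_sub_le {n : ℕ} (hn : 0 < n) (x : ℝ) : |truncate n x - x| ≤ x ^ 2 / n := by
  have hn' : (0 : ℝ) < n := Nat.cast_pos.mpr hn
  rcases le_or_gt |x| n with h | h
  · rw [truncate_eq_self h, sub_self, abs_zero]; positivity
  · have h1 : |truncate n x - x| ≤ |x| := by
      simp only [truncate]
      rcases abs_cases x with h | h <;> rcases max_cases (-(n : ℝ)) (min n x) with h' | h' <;>
        rcases min_cases (n : ℝ) x with h'' | h'' <;> rw [abs_le] <;> constructor <;> linarith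
    refine h1.trans ?_
    rw [le_div_iff₀ hn', ← sq_abs x, pow_two]
    exact mul_le_mul_of_nonneg_left h.le (abs_nonneg x)

theorem tendsto_truncate (x : ℝ) : Tendsto (fun n => truncate n x) atTop (𝓝 x) := by
  obtain ⟨N, hN⟩ := exists_nat_ge |x|
  refine tendsto_atTop_of_eventually_const (i₀ := N) fun n hn => truncate_eq_self ?_
  exact hN.trans (Nat.cast_le.mpr hn)

/-- Only bounded continuous functions pass to the weak limit, so moments are recovered from
truncations. The second-moment bound gives a uniform `L¹` bound, hence integrability by Fatou;
dominated convergence then identifies the mean. -/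
theorem integrable_and_integral_eq_of_truncate {Ω : Type*} [MeasurableSpace Ω] {P : Measure Ω}
    [IsProbabilityMeasure P] {X : Ω → ℝ} (hX : Measurable X) {M r : ℝ}
    (h₁ : ∀ n : ℕ, 0 < n → |(∫ ω, truncate n (X ω) ∂P) - r| ≤ M / n)
    (h₂ : ∀ n : ℕ, ∫ ω, truncate n (X ω) ^ 2 ∂P ≤ M) :
    Integrable X P ∧ ∫ ω, X ω ∂P = r := by
  have hm : ∀ n, Measurable fun ω => truncate n (X ω) := fun n =>
    (continuous_truncate n).measurable.comp hX
  have hi : ∀ n, Integrable (fun ω => truncate n (X ω)) P := fun n =>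
    Integrable.of_bound (hm n).aestronglyMeasurable n
      (Eventually.of_forall fun ω => abs_truncate_le n _)
  have hi2 : ∀ n, Integrable (fun ω => truncate n (X ω) ^ 2) P := fun n =>
    Integrable.of_bound ((hm n).pow_const 2).aestronglyMeasurable ((n : ℝ) ^ 2)
      (Eventually.of_forall fun ω => by
        rw [Real.norm_eq_abs, abs_pow]
        exact pow_le_pow_left₀ (abs_nonneg _) (abs_truncate_le n _) 2)
  have hbd : ∀ n, ∫⁻ ω, ‖truncate n (X ω)‖ₑ ∂P ≤ ENNReal.ofReal (1 + M) := by
    intro n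
    rw [← ofReal_integral_norm_eq_lintegral_enorm (hi n)]
    refine ENNReal.ofReal_le_ofReal ?_
    calc ∫ ω, ‖truncate n (X ω)‖ ∂P ≤ ∫ ω, (1 + truncate n (X ω) ^ 2) ∂P := by
          refine integral_mono (hi n).norm ((integrable_const 1).add (hi2 n)) fun ω => ?_
          simp only [Real.norm_eq_abs]
          rw [← sq_abs]
          nlinarith [sq_nonneg (|truncate n (X ω)| - 1)]
      _ = 1 + ∫ ω, truncate n (X ω) ^ 2 ∂P := by
          rw [integral_add (integrable_const 1) (hi2 n)]; simp
      _ ≤ 1 + M := by linarith [h₂ n]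
  have hint : Integrable X P := by
    refine ⟨hX.aestronglyMeasurable, ?_⟩
    refine lt_of_le_of_lt ?_ (ENNReal.ofReal_lt_top (r := 1 + M))
    calc ∫⁻ ω, ‖X ω‖ₑ ∂P = ∫⁻ ω, liminf (fun n => ‖truncate n (X ω)‖ₑ) atTop ∂P := by
          refine lintegral_congr fun ω => ?_
          exact ((tendsto_truncate (X ω)).enorm).liminf_eq.symm
      _ ≤ liminf (fun n => ∫⁻ ω, ‖truncate n (X ω)‖ₑ ∂P) atTop :=
          lintegral_liminf_le fun n => (hm n).enorm
      _ ≤ ENNReal.ofReal (1 + M) := liminf_le_of_le (by isBoundedDefault) fun b hb => by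
          obtain ⟨n, hn⟩ := hb.exists
          exact hn.trans (hbd n)
  refine ⟨hint, ?_⟩
  have hlim : Tendsto (fun n => ∫ ω, truncate n (X ω) ∂P) atTop (𝓝 (∫ ω, X ω ∂P)) :=
    tendsto_integral_of_dominated_convergence (fun ω => ‖X ω‖)
      (fun n => (hm n).aestronglyMeasurable) hint.norm
      (fun n => Eventually.of_forall fun ω => abs_truncate_le_abs n _)
      (Eventually.of_forall fun ω => tendsto_truncate _)
  have hlim' : Tendsto (fun n => ∫ ω, truncate n (X ω) ∂P) atTop (𝓝 r) := by
    rw [tendsto_iff_norm_sub_tendsto_zero]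
    refine squeeze_zero' (Eventually.of_forall fun n => norm_nonneg _) ?_
      (tendsto_const_div_atTop_nhds_zero_nat M)
    filter_upwards [eventually_gt_atTop 0] with n hn using h₁ n hn
  exact tendsto_nhds_unique hlim hlim'

/-- Truncation of an extended real number to `[-n, n]`. -/
def erealTruncate (n : ℕ) (x : EReal) : ℝ :=
  (max ((-n : ℝ) : EReal) (min ((n : ℝ) : EReal) x)).toReal

theorem erealTruncate_coe (n : ℕ) (x : ℝ) : erealTruncate n x = truncate n x := by
  rw [erealTruncate, ← EReal.coe_strictMono.monotone.map_min,
    ← EReal.coe_strictMono.monotone.map_max, EReal.toReal_coe, truncate]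

theorem continuous_erealTruncate (n : ℕ) : Continuous (erealTruncate n) := by
  refine EReal.continuousOn_toReal.comp_continuous
    (continuous_const.max (continuous_const.min continuous_id)) fun x => ?_
  have h₁ : (⊥ : EReal) < max ((-n : ℝ) : EReal) (min ((n : ℝ) : EReal) x) :=
    lt_max_of_lt_left (EReal.bot_lt_coe _)
  have h₂ : max ((-n : ℝ) : EReal) (min ((n : ℝ) : EReal) x) < ⊤ :=
    max_lt (EReal.coe_lt_top _) (min_lt_of_left_lt (EReal.coe_lt_top _))
  simp only [Set.mem_compl_iff, Set.mem_insert_iff, Set.mem_singleton_iff, not_or]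
  exact ⟨h₁.ne', h₂.ne⟩

end Truncation

/-! ### Finitely generated subalgebras and bounded characters -/

section Subalgebras

variable {A κ : Type*} [CommRing A] [Algebra ℝ A]

/-- The subalgebra generated by the members of a family with index in a finite set. -/
abbrev finAdjoin (u : κ → A) (t : Finset κ) : Subalgebra ℝ A :=
  Algebra.adjoin ℝ (u '' (t : Set κ))

theorem finAdjoin_mono (u : κ → A) {s t : Finset κ} (h : s ⊆ t) :
    finAdjoin u s ≤ finAdjoin u t :=
  Algebra.adjoin_mono (Set.image_mono (Finset.coe_subset.mpr h))

theorem mem_finAdjoin (u : κ → A) {t : Finset κ} {k : κ} (h : k ∈ t) : u k ∈ finAdjoin u t :=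
  Algebra.subset_adjoin (Set.mem_image_of_mem u h)

theorem exists_mem_finAdjoin {u : κ → A} (hu : Algebra.adjoin ℝ (Set.range u) = ⊤) (a : A) :
    ∃ t : Finset κ, a ∈ finAdjoin u t := by
  classical
  have ha : a ∈ Algebra.adjoin ℝ (Set.range u) := hu ▸ Algebra.mem_top
  induction ha using Algebra.adjoin_induction with
  | mem x hx =>
    obtain ⟨k, rfl⟩ := hx
    exact ⟨{k}, mem_finAdjoin u (Finset.mem_singleton_self k)⟩
  | algebraMap r => exact ⟨∅, Subalgebra.algebraMap_mem _ r⟩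
  | add x y _ _ hx hy =>
    obtain ⟨s, hs⟩ := hx
    obtain ⟨t, ht⟩ := hy
    exact ⟨s ∪ t, add_mem (finAdjoin_mono u Finset.subset_union_left hs)
      (finAdjoin_mono u Finset.subset_union_right ht)⟩
  | mul x y _ _ hx hy =>
    obtain ⟨s, hs⟩ := hx
    obtain ⟨t, ht⟩ := hy
    exact ⟨s ∪ t, mul_mem (finAdjoin_mono u Finset.subset_union_left hs)
      (finAdjoin_mono u Finset.subset_union_right ht)⟩

/-- The characters of a finitely generated subalgebra that are bounded by `c` on the generators. -/
def boundedChars (u : κ → A) (c : κ → ℝ) (t : Finset κ) : Set (CharSpace (finAdjoin u t)) :=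
  {α | ∀ k (hk : k ∈ t), |α ⟨u k, mem_finAdjoin u hk⟩| ≤ c k}

theorem isCompact_boundedChars (u : κ → A) (c : κ → ℝ) (t : Finset κ) :
    IsCompact (boundedChars u c t) := by
  have h : Algebra.adjoin ℝ (Set.range fun k : t =>
      (⟨u k, mem_finAdjoin u k.2⟩ : finAdjoin u t)) = ⊤ := by
    rw [← Algebra.adjoin_adjoin_coe_preimage (R := ℝ) (s := u '' (t : Set κ))]
    congr 1
    ext ⟨x, hx⟩
    simp [Subtype.ext_iff]
  refine (CharSpace.isCompact_setOf_abs_le h fun k : t => c k).of_isClosed_subset ?_ ?_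
  · simp only [boundedChars, Set.ofPred_forall]
    exact isClosed_iInter fun k => isClosed_iInter fun _ =>
      isClosed_le (CharSpace.continuous_eval _).abs continuous_const
  · exact fun α hα k => hα k k.2

/-- The functions `A → [-∞, ∞]` extending a character in `boundedChars u c t`. -/
def boundedExtensions (u : κ → A) (c : κ → ℝ) (t : Finset κ) : Set (A → EReal) :=
  {y | ∃ α ∈ boundedChars u c t, ∀ a : finAdjoin u t, y a = ((α a : ℝ) : EReal)}

theorem isClosed_boundedExtensions (u : κ → A) (c : κ → ℝ) (t : Finset κ) :
    IsClosed (boundedExtensions u c t) := by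
  have hρ : Continuous fun (y : A → EReal) (a : finAdjoin u t) => y a :=
    continuous_pi fun a => continuous_apply (a : A)
  have := ((isCompact_boundedChars u c t).image CharSpace.continuous_toEReal).isClosed.preimage hρ
  convert this using 1
  ext y
  constructor
  · rintro ⟨α, hα, h⟩
    exact ⟨α, hα, funext fun a => (h a).symm⟩
  · rintro ⟨α, hα, h⟩
    exact ⟨α, hα, fun a => (congrFun h a).symm⟩

theorem boundedExtensions_anti (u : κ → A) (c : κ → ℝ) : Antitone (boundedExtensions u c) := by
  rintro s t hst y ⟨α, hα, h⟩
  exact ⟨α.comp (Subalgebra.inclusion (finAdjoin_mono u hst)), fun k hk => hα k (hst hk),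
    fun a => h (Subalgebra.inclusion (finAdjoin_mono u hst) a)⟩

/-- Any two elements of `A` lie in a common finitely generated subalgebra, so a point that is a
bounded character on each of these is finite everywhere and is a bounded character of `A`. -/
theorem iInter_boundedExtensions {u : κ → A} (hu : Algebra.adjoin ℝ (Set.range u) = ⊤)
    (c : κ → ℝ) :
    ⋂ t, boundedExtensions u c t = CharSpace.toEReal '' {α | ∀ k, |α (u k)| ≤ c k} := by
  classical
  ext y
  rw [Set.mem_iInter]
  constructor
  · intro h
    choose α hα hy using h
    have hreal : ∀ t (a : A) (ha : a ∈ finAdjoin u t), (y a).toReal = α t ⟨a, ha⟩ :=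
      fun t a ha => by rw [hy t ⟨a, ha⟩, EReal.toReal_coe]
    have hcoe : ∀ a, ((y a).toReal : EReal) = y a := by
      intro a
      obtain ⟨t, ht⟩ := exists_mem_finAdjoin hu a
      rw [hy t ⟨a, ht⟩, EReal.toReal_coe]
    have hpair : ∀ a b : A, ∃ t, a ∈ finAdjoin u t ∧ b ∈ finAdjoin u t := by
      intro a b
      obtain ⟨s, hs⟩ := exists_mem_finAdjoin hu a
      obtain ⟨t, ht⟩ := exists_mem_finAdjoin hu b
      exact ⟨s ∪ t, finAdjoin_mono u Finset.subset_union_left hs,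
        finAdjoin_mono u Finset.subset_union_right ht⟩
    let β : A →ₗ[ℝ] ℝ :=
    { toFun a := (y a).toReal
      map_add' a b := by
        obtain ⟨t, ha, hb⟩ := hpair a b
        rw [hreal t a ha, hreal t b hb, hreal t _ (add_mem ha hb), ← map_add]
        rfl
      map_smul' r a := by
        obtain ⟨t, ha⟩ := exists_mem_finAdjoin hu a
        rw [hreal t a ha, hreal t _ (Subalgebra.smul_mem _ ha r), RingHom.id_apply, ← map_smul]
        rfl }
    have h1 : β 1 = 1 := (hreal ∅ 1 (one_mem _)).trans (map_one (α ∅))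
    have hmul : ∀ a b, β (a * b) = β a * β b := by
      intro a b
      obtain ⟨t, ha, hb⟩ := hpair a b
      change (y (a * b)).toReal = (y a).toReal * (y b).toReal
      rw [hreal t a ha, hreal t b hb, hreal t _ (mul_mem ha hb), ← map_mul]
      rfl
    refine ⟨AlgHom.ofLinearMap β h1 hmul, fun k => ?_, funext fun a => hcoe a⟩
    have hk := hα {k} k (Finset.mem_singleton_self k)
    rwa [← hreal] at hk
  · rintro ⟨α, hα, rfl⟩ t
    exact ⟨α.comp (finAdjoin u t).val, fun k _ => hα k, fun a => rfl⟩

theorem extendZero_mem_boundedExtensions {u : κ → A} {c : κ → ℝ} {s t : Finset κ} (h : s ⊆ t)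
    {α : CharSpace (finAdjoin u t)} (hα : α ∈ boundedChars u c t) :
    CharSpace.extendZero (finAdjoin u t) α ∈ boundedExtensions u c s :=
  boundedExtensions_anti u c h ⟨α, hα, fun a => CharSpace.extendZero_of_mem _ α a.2⟩

end Subalgebras

/-! ### From uniform tightness to a representing measure -/

section Representation

variable {A κ : Type*} [CommRing A] [Algebra ℝ A]

theorem IsRepresentingRadonMeasure.isProbabilityMeasure {L : A →ₗ[ℝ] ℝ} (hL : L 1 = 1)
    {ν : Measure (CharSpace A)} (h : IsRepresentingRadonMeasure L ν) :
    IsProbabilityMeasure ν := by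
  have h1 := h.integral_eq 1
  simp only [map_one, integral_const, smul_eq_mul, mul_one, hL, measureReal_def] at h1
  exact ⟨(ENNReal.toReal_eq_one_iff _).mp h1.symm⟩

/-- The characters of `A` bounded by `n • w` on the generators, embedded into `A → [-∞, ∞]`. -/
def embeddedBall (u : κ → A) (w : κ → ℝ) (n : ℕ) : Set (A → EReal) :=
  CharSpace.toEReal '' {α : CharSpace A | ∀ k, |α (u k)| ≤ n * w k}

theorem isCompact_embeddedBall {u : κ → A} (hu : Algebra.adjoin ℝ (Set.range u) = ⊤)
    (w : κ → ℝ) (n : ℕ) : IsCompact (embeddedBall u w n) :=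
  (CharSpace.isCompact_setOf_abs_le hu _).image CharSpace.continuous_toEReal

theorem embeddedBall_mono (u : κ → A) {w : κ → ℝ} (hw : ∀ k, 0 ≤ w k) :
    Monotone (embeddedBall u w) := by
  intro m n hmn
  refine Set.image_mono fun α hα k => (hα k).trans ?_
  exact mul_le_mul_of_nonneg_right (Nat.cast_le.mpr hmn) (hw k)

/-- The ball is a decreasing intersection of closed sets, so any open `U` around it already contains
one of them. An Urysohn function between that set and `U` transfers the mass bound to the limit;
outer regularity shrinks `U` to the ball. -/
theorem one_sub_le_measureReal_embeddedBall [MeasurableSpace (A → EReal)] [BorelSpace (A → EReal)]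
    {u : κ → A} (hu : Algebra.adjoin ℝ (Set.range u) = ⊤) {w : κ → ℝ}
    {ν : ∀ t : Finset κ, Measure (CharSpace (finAdjoin u t))} [∀ t, IsProbabilityMeasure (ν t)]
    {l : Filter (Finset κ)} [l.NeBot] (hl : l ≤ atTop)
    {μ : Measure (A → EReal)} [IsProbabilityMeasure μ] [μ.Regular]
    (hμ : ∀ f : C(A → EReal, ℝ), Tendsto
      (fun t => ∫ α, f (CharSpace.extendZero (finAdjoin u t) α) ∂ν t) l (𝓝 (∫ y, f y ∂μ)))
    {ε : ℝ} {n : ℕ}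
    (h : ∀ t, (ν t).real (boundedChars u (fun k => n * w k) t)ᶜ ≤ ε) :
    1 - ε ≤ μ.real (embeddedBall u w n) := by
  classical
  by_contra! hlt
  have hlt' : μ (embeddedBall u w n) < ENNReal.ofReal (1 - ε) := by
    rw [← ofReal_measureReal]
    exact (ENNReal.ofReal_lt_ofReal_iff (measureReal_nonneg.trans_lt hlt)).mpr hlt
  obtain ⟨U, hKU, hU, hμU⟩ := (embeddedBall u w n).exists_isOpen_lt_of_lt _ hlt'
  obtain ⟨s, hs⟩ := exists_subset_nhds_of_compactSpace
    (V := boundedExtensions u fun k => n * w k)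
    (directed_of_isDirected_le (boundedExtensions_anti u _))
    (isClosed_boundedExtensions u _) (U := U) fun y hy => hU.mem_nhds (hKU (by
      rwa [embeddedBall, ← iInter_boundedExtensions hu]))
  obtain ⟨f, hf0, hf1, hf⟩ := exists_continuous_zero_one_of_isClosed hU.isClosed_compl
    (isClosed_boundedExtensions u (fun k => n * w k) s)
    (Set.disjoint_compl_left_iff_subset.mpr hs)
  have hfμ : ∫ y, f y ∂μ ≤ μ.real U := by
    rw [← integral_indicator_one hU.measurableSet]
    refine integral_mono (f.continuous.integrable_of_hasCompactSupport
      (HasCompactSupport.of_compactSpace _))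
      ((integrable_const (1 : ℝ)).indicator hU.measurableSet) fun y => ?_
    by_cases hy : y ∈ U
    · rw [Set.indicator_of_mem hy]; exact (hf y).2
    · rw [Set.indicator_of_notMem hy, hf0 hy]; rfl
  have hfν : ∀ᶠ t in l, 1 - ε ≤ ∫ α, f (CharSpace.extendZero (finAdjoin u t) α) ∂ν t := by
    filter_upwards [hl (eventually_ge_atTop s)] with t ht
    have hmeas : MeasurableSet (boundedChars u (fun k => n * w k) t) :=
      (isCompact_boundedChars u _ t).isClosed.measurableSet
    have hcont : Continuous fun α => f (CharSpace.extendZero (finAdjoin u t) α) :=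
      f.continuous.comp (CharSpace.continuous_extendZero _)
    have h1 := h t
    rw [probReal_compl_eq_one_sub hmeas] at h1
    have h2 : (ν t).real (boundedChars u (fun k => n * w k) t) ≤
        ∫ α, f (CharSpace.extendZero (finAdjoin u t) α) ∂ν t := by
      rw [← integral_indicator_one hmeas]
      refine integral_mono ((integrable_const (1 : ℝ)).indicator hmeas)
        (Integrable.of_bound hcont.measurable.aestronglyMeasurable 1
          (Eventually.of_forall fun α => ?_)) fun α => ?_
      · rw [Real.norm_eq_abs, abs_of_nonneg (hf _).1]; exact (hf _).2
      · by_cases hα : α ∈ boundedChars u (fun k => n * w k) t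
        · rw [Set.indicator_of_mem hα]
          exact (hf1 (extendZero_mem_boundedExtensions ht hα)).ge
        · rw [Set.indicator_of_notMem hα]; exact (hf _).1
    linarith
  have h3 : 1 - ε ≤ μ.real U := (ge_of_tendsto (hμ f) hfν).trans hfμ
  have h4 : μ.real U < 1 - ε := by
    rw [← ofReal_measureReal] at hμU
    exact (ENNReal.ofReal_lt_ofReal_iff_of_nonneg measureReal_nonneg).mp hμU
  linarith

open Classical in
/-- A left inverse of `CharSpace.toEReal` on the union of all `embeddedBall u w n`, constant
elsewhere. -/
def embeddedBallInv (u : κ → A) (w : κ → ℝ) (α₀ : CharSpace A) (y : A → EReal) : CharSpace A :=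
  if h : ∃ α : CharSpace A, (∃ n : ℕ, ∀ k, |α (u k)| ≤ n * w k) ∧ α.toEReal = y then h.choose
  else α₀

theorem embeddedBallInv_toEReal {u : κ → A} {w : κ → ℝ} (α₀ : CharSpace A) {α : CharSpace A}
    {n : ℕ} (h : ∀ k, |α (u k)| ≤ n * w k) : embeddedBallInv u w α₀ α.toEReal = α := by
  have hex : ∃ β : CharSpace A, (∃ n : ℕ, ∀ k, |β (u k)| ≤ n * w k) ∧
    β.toEReal = α.toEReal := ⟨α, ⟨n, h⟩, rfl⟩
  rw [embeddedBallInv, dif_pos hex]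
  exact CharSpace.toEReal_injective hex.choose_spec.2

theorem embeddedBallInv_of_notMem {u : κ → A} {w : κ → ℝ} (α₀ : CharSpace A) {y : A → EReal}
    (h : y ∉ ⋃ n, embeddedBall u w n) : embeddedBallInv u w α₀ y = α₀ := by
  refine dif_neg ?_
  rintro ⟨α, ⟨n, hα⟩, rfl⟩
  exact h (Set.mem_iUnion.mpr ⟨n, α, hα, rfl⟩)

/-- On the union of balls, the preimage of a closed set is a countable union of compact sets; off it
the map is constant. -/
theorem measurable_embeddedBallInv [MeasurableSpace (A → EReal)] [BorelSpace (A → EReal)]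
    {u : κ → A} (hu : Algebra.adjoin ℝ (Set.range u) = ⊤) (w : κ → ℝ) (α₀ : CharSpace A) :
    Measurable (embeddedBallInv u w α₀) := by
  have hZ : MeasurableSet (⋃ n, embeddedBall u w n) :=
    .iUnion fun n => (isCompact_embeddedBall hu w n).isClosed.measurableSet
  refine measurable_of_isClosed fun F hF => ?_
  have hF' : MeasurableSet (⋃ n : ℕ, CharSpace.toEReal ''
      ({α : CharSpace A | ∀ k, |α (u k)| ≤ n * w k} ∩ F)) :=
    .iUnion fun n => (((CharSpace.isCompact_setOf_abs_le hu _).inter_right hF).image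
      CharSpace.continuous_toEReal).isClosed.measurableSet
  have : embeddedBallInv u w α₀ ⁻¹' F = (⋃ n : ℕ, CharSpace.toEReal ''
      ({α : CharSpace A | ∀ k, |α (u k)| ≤ n * w k} ∩ F)) ∪
        ((⋃ n, embeddedBall u w n)ᶜ ∩ {_y | α₀ ∈ F}) := by
    ext y
    by_cases hy : y ∈ ⋃ n, embeddedBall u w n
    · obtain ⟨n, α, hα, rfl⟩ := Set.mem_iUnion.mp hy
      simp only [Set.mem_preimage, embeddedBallInv_toEReal α₀ hα, Set.mem_union, Set.mem_inter_iff,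
        Set.mem_compl_iff, hy, not_true_eq_false, false_and, or_false]
      constructor
      · exact fun h => Set.mem_iUnion.mpr ⟨n, α, ⟨hα, h⟩, rfl⟩
      · intro h
        obtain ⟨m, β, ⟨-, hβ⟩, hβα⟩ := Set.mem_iUnion.mp h
        rwa [← CharSpace.toEReal_injective hβα]
    · simp only [Set.mem_preimage, embeddedBallInv_of_notMem α₀ hy, Set.mem_union,
        Set.mem_inter_iff, Set.mem_compl_iff, hy, not_false_eq_true, true_and]
      constructor
      · exact fun h => Or.inr h
      · rintro (h | h)
        · obtain ⟨n, α, ⟨hα, -⟩, hy'⟩ := Set.mem_iUnion.mp h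
          exact absurd (Set.mem_iUnion_of_mem n (by exact ⟨α, hα, hy'⟩)) hy
        · exact h
  rw [this]
  exact hF'.union (hZ.compl.inter (MeasurableSet.const _))

/-- A functional whose restrictions to the finitely generated subalgebras have uniformly tight
representing measures is represented by a Radon measure. -/
theorem exists_isRepresentingRadonMeasure_of_tight {u : κ → A}
    (hu : Algebra.adjoin ℝ (Set.range u) = ⊤) {w : κ → ℝ} (hw : ∀ k, 0 ≤ w k)
    [Nonempty (CharSpace A)] {L : A →ₗ[ℝ] ℝ} (hL : L 1 = 1)
    {ν : ∀ t : Finset κ, Measure (CharSpace (finAdjoin u t))}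
    (hν : ∀ t, IsRepresentingRadonMeasure (L ∘ₗ (finAdjoin u t).val.toLinearMap) (ν t))
    (htight : ∀ ε : ℝ, 0 < ε →
      ∃ n : ℕ, ∀ t, (ν t).real (boundedChars u (fun k => n * w k) t)ᶜ ≤ ε) :
    ∃ μ : Measure (CharSpace A), IsRepresentingRadonMeasure L μ ∧
      μ {α | ∃ n : ℕ, ∀ k, |α (u k)| ≤ n * w k}ᶜ = 0 := by
  classical
  obtain ⟨α₀⟩ := ‹Nonempty (CharSpace A)›
  let _ : MeasurableSpace (A → EReal) := borel _
  have _ : BorelSpace (A → EReal) := ⟨rfl⟩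
  have hprob : ∀ t, IsProbabilityMeasure (ν t) := fun t =>
    (hν t).isProbabilityMeasure (by simpa using hL)
  have hext : ∀ t, Measurable (CharSpace.extendZero (finAdjoin u t)) := fun t =>
    (CharSpace.continuous_extendZero _).measurable
  have hprob' : ∀ t, IsProbabilityMeasure ((ν t).map (CharSpace.extendZero (finAdjoin u t))) :=
    fun t => Measure.isProbabilityMeasure_map (hext t).aemeasurable
  -- Being finer than `atTop`, the ultrafilter eventually sees every given element of `A` inside
  -- `finAdjoin u t`, where extension by zero is the true evaluation.
  set l : Ultrafilter (Finset κ) := Ultrafilter.of atTop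
  have hl : (l : Filter (Finset κ)) ≤ atTop := Ultrafilter.of_le _
  obtain ⟨μ, hμp, hμr, hμ'⟩ := exists_regular_limit l fun t =>
    (ν t).map (CharSpace.extendZero (finAdjoin u t))
  have hμ : ∀ f : C(A → EReal, ℝ), Tendsto
      (fun t => ∫ α, f (CharSpace.extendZero (finAdjoin u t) α) ∂ν t) l (𝓝 (∫ y, f y ∂μ)) :=
    fun f => (hμ' f).congr fun t => integral_map (hext t).aemeasurable
      f.continuous.measurable.aestronglyMeasurable
  set g := embeddedBallInv u w α₀ with hg
  have hgm : Measurable g := measurable_embeddedBallInv hu w α₀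
  have hball : ∀ n, MeasurableSet (embeddedBall u w n) := fun n =>
    (isCompact_embeddedBall hu w n).isClosed.measurableSet
  have hZ : ∀ᵐ y ∂μ, y ∈ ⋃ n, embeddedBall u w n := by
    have h1 : μ.real (⋃ n, embeddedBall u w n)ᶜ = 0 := by
      refine le_antisymm (le_of_forall_pos_le_add fun ε hε => ?_) measureReal_nonneg
      obtain ⟨n, hn⟩ := htight ε hε
      have h2 := one_sub_le_measureReal_embeddedBall hu hl hμ hn
      have h3 : μ.real (embeddedBall u w n) ≤ μ.real (⋃ n, embeddedBall u w n) :=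
        measureReal_mono (Set.subset_iUnion _ n)
      rw [probReal_compl_eq_one_sub (.iUnion hball)]
      linarith
    exact (measureReal_eq_zero_iff).mp h1
  have hgj : ∀ᵐ y ∂μ, (g y).toEReal = y := by
    filter_upwards [hZ] with y hy
    obtain ⟨n, α, hα, rfl⟩ := Set.mem_iUnion.mp hy
    rw [hg, embeddedBallInv_toEReal α₀ hα]
  have hprobg : IsProbabilityMeasure (μ.map g) := Measure.isProbabilityMeasure_map hgm.aemeasurable
  have hlim : ∀ (a : A) (φ : ℝ → ℝ) (hφ : Continuous φ) (n : ℕ),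
      Tendsto (fun t => ∫ α, φ (erealTruncate n (CharSpace.extendZero (finAdjoin u t) α a)) ∂ν t) l
        (𝓝 (∫ α : CharSpace A, φ (truncate n (α a)) ∂μ.map g)) := by
    intro a φ hφ n
    have hc : Continuous fun α : CharSpace A => φ (truncate n (α a)) :=
      hφ.comp ((continuous_truncate n).comp (CharSpace.continuous_eval a))
    rw [integral_map hgm.aemeasurable hc.measurable.aestronglyMeasurable]
    have h1 := hμ ⟨fun y => φ (erealTruncate n (y a)),
      hφ.comp ((continuous_erealTruncate n).comp (continuous_apply a))⟩
    refine h1.trans_eq (congrArg 𝓝 (integral_congr_ae ?_))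
    filter_upwards [hgj] with y hy
    simp only [ContinuousMap.coe_mk]
    rw [← erealTruncate_coe]
    exact congrArg (fun y : A → EReal => φ (erealTruncate n (y a))) hy.symm
  have hev : ∀ a : A, ∀ᶠ t in (l : Filter (Finset κ)), a ∈ finAdjoin u t := by
    intro a
    obtain ⟨s, hs⟩ := exists_mem_finAdjoin hu a
    filter_upwards [hl (eventually_ge_atTop s)] with t ht using finAdjoin_mono u ht hs
  have hsq : ∀ t (a : A) (ha : a ∈ finAdjoin u t),
      Integrable (fun α : CharSpace (finAdjoin u t) => α ⟨a, ha⟩ ^ 2) (ν t) ∧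
        ∫ α : CharSpace (finAdjoin u t), α ⟨a, ha⟩ ^ 2 ∂ν t = L (a ^ 2) := by
    intro t a ha
    have h1 := (hν t).integrable (⟨a, ha⟩ ^ 2)
    have h2 := (hν t).integral_eq (⟨a, ha⟩ ^ 2)
    simp only [map_pow] at h1 h2
    exact ⟨h1, h2.symm⟩
  have htr : ∀ t (a : A) (ha : a ∈ finAdjoin u t) (n : ℕ),
      Integrable (fun α : CharSpace (finAdjoin u t) => truncate n (α ⟨a, ha⟩)) (ν t) := by
    intro t a ha n
    exact Integrable.of_bound ((continuous_truncate n).comp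
      (CharSpace.continuous_eval _)).measurable.aestronglyMeasurable n
      (Eventually.of_forall fun α => abs_truncate_le n _)
  have hmom : ∀ a : A, Integrable (fun α : CharSpace A => α a) (μ.map g) ∧
      ∫ α : CharSpace A, α a ∂μ.map g = L a := by
    intro a
    refine integrable_and_integral_eq_of_truncate (CharSpace.continuous_eval a).measurable
      (M := L (a ^ 2)) (fun n hn => ?_) fun n => ?_
    · refine le_of_tendsto ((hlim a id continuous_id n).sub_const (L a)).abs ?_
      filter_upwards [hev a] with t ht
      have h1 := (hν t).integral_eq ⟨a, ht⟩
      change L a = _ at h1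
      simp only [id, CharSpace.extendZero_of_mem _ _ ht, erealTruncate_coe]
      rw [h1, ← integral_sub (htr t a ht n) ((hν t).integrable _), ← (hsq t a ht).2,
        ← integral_div]
      refine (abs_integral_le_integral_abs).trans (integral_mono
        ((htr t a ht n).sub ((hν t).integrable _)).abs ((hsq t a ht).1.div_const _) fun α => ?_)
      exact abs_truncate_sub_le hn _
    · refine le_of_tendsto (hlim a (fun x => x ^ 2) (continuous_pow 2) n) ?_
      filter_upwards [hev a] with t ht
      simp only [CharSpace.extendZero_of_mem _ _ ht, erealTruncate_coe]
      rw [← (hsq t a ht).2]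
      refine integral_mono_of_nonneg (Eventually.of_forall fun α => sq_nonneg _) (hsq t a ht).1
        (Eventually.of_forall fun α => sq_le_sq.mpr (abs_truncate_le_abs n _))
  refine ⟨μ.map g, ⟨⟨inferInstance, ⟨fun B hB r hr => ?_⟩⟩, fun a => (hmom a).1,
    fun a => (hmom a).2.symm⟩, ?_⟩
  -- Inner regularity: the balls exhaust almost all mass, and a compact subset of one ball pulls
  -- back to a compact set of characters.
  · rw [Measure.map_apply hgm hB] at hr
    have h1 : μ (g ⁻¹' B) = μ (⋃ n, g ⁻¹' B ∩ embeddedBall u w n) := by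
      rw [← Set.inter_iUnion]
      refine measure_congr ?_
      filter_upwards [hZ] with y hy
      exact propext ⟨fun h => ⟨h, hy⟩, fun h => h.1⟩
    rw [h1, Monotone.measure_iUnion fun m n hmn =>
      Set.inter_subset_inter_right _ (embeddedBall_mono u hw hmn), lt_iSup_iff] at hr
    obtain ⟨n, hn⟩ := hr
    obtain ⟨Q, hQs, hQ, hrQ⟩ := ((hgm hB).inter (hball n)).exists_lt_isCompact hn
    have hcl : IsClosed (CharSpace.toEReal (A := A) ⁻¹' Q) :=
      hQ.isClosed.preimage CharSpace.continuous_toEReal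
    have hcpt := (CharSpace.isCompact_setOf_abs_le hu fun k => n * w k).inter_right hcl
    refine ⟨_, ?_, hcpt, hrQ.trans_le ?_⟩
    · rintro α ⟨hα, hαQ⟩
      have := (hQs hαQ).1
      rwa [Set.mem_preimage, hg, embeddedBallInv_toEReal α₀ hα] at this
    · rw [Measure.map_apply hgm hcpt.isClosed.measurableSet]
      refine measure_mono fun y hy => ?_
      obtain ⟨α, hα, rfl⟩ := (hQs hy).2
      rw [Set.mem_preimage, hg, embeddedBallInv_toEReal α₀ hα]
      exact ⟨hα, hy⟩
  · have hm : MeasurableSet {α : CharSpace A | ∃ n : ℕ, ∀ k, |α (u k)| ≤ n * w k} := by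
      rw [Set.ofPred_exists]
      exact .iUnion fun n => (CharSpace.isClosed_setOf_abs_le u _).measurableSet
    rw [Measure.map_apply hgm hm.compl]
    refine measure_mono_null ?_ hZ
    intro y hy hyZ
    obtain ⟨n, α, hα, rfl⟩ := Set.mem_iUnion.mp hyZ
    refine hy ⟨n, ?_⟩
    rwa [hg, embeddedBallInv_toEReal α₀ hα]

end Representation

/-! ### Concentration implies uniform tightness -/

section Concentrated

variable {A : Type*} [CommRing A] [Algebra ℝ A]

theorem finAdjoin_mem_finGenBy (V : Submodule ℝ A) (t : Finset V) :
    finAdjoin (Subtype.val : V → A) t ∈ FinGenBy V := by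
  classical
  refine ⟨Submodule.span ℝ (Subtype.val '' (t : Set V)), ?_, ?_, (Algebra.adjoin_span ℝ).symm⟩
  · rw [Submodule.span_le]
    rintro _ ⟨v, -, rfl⟩
    exact v.2
  · exact FiniteDimensional.span_of_finite ℝ (t.finite_toSet.image _)

/-- The inclusion of the linear span of finitely many vectors into the algebra they generate. -/
def spanToFinAdjoin (V : Submodule ℝ A) (t : Finset V) :
    Submodule.span ℝ (t : Set V) →ₗ[ℝ] finAdjoin (Subtype.val : V → A) t :=
  LinearMap.codRestrict (Subalgebra.toSubmodule (finAdjoin (Subtype.val : V → A) t))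
    (V.subtype ∘ₗ (Submodule.span ℝ (t : Set V)).subtype) fun x => by
      have : Submodule.span ℝ (t : Set V) ≤
          (Subalgebra.toSubmodule (finAdjoin (Subtype.val : V → A) t)).comap V.subtype :=
        Submodule.span_le.mpr fun v hv => mem_finAdjoin Subtype.val hv
      exact this x.2

theorem Seminorm.IsFiniteOrthonormal.map_subtype {E : Type*} [AddCommGroup E] [Module ℝ E]
    {q : Seminorm ℝ E} {F : Submodule ℝ E} {s : Finset F}
    (hs : (q.comp F.subtype).IsFiniteOrthonormal s) :
    q.IsFiniteOrthonormal (s.map (Function.Embedding.subtype _)) := by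
  constructor
  · intro x hx y hy hxy
    obtain ⟨x', hx', rfl⟩ := Finset.mem_map.mp hx
    obtain ⟨y', hy', rfl⟩ := Finset.mem_map.mp hy
    exact hs.1 x' hx' y' hy' fun h => hxy (h ▸ rfl)
  · intro x hx
    obtain ⟨x', hx', rfl⟩ := Finset.mem_map.mp hx
    exact hs.2 x' hx'

/-- Orthonormal sets in the span of `t` remain orthonormal in `V`, so the same trace bounds every
finite-dimensional piece and the estimate does not depend on `t`. -/
theorem measureReal_compl_boundedChars_le {V : Submodule ℝ A} {p q : Seminorm ℝ V}
    (hp : p.IsHilbertian) (hq : q.IsHilbertian) (hpq : p.traceRel q < ∞) (t : Finset V)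
    {P : Measure (CharSpace (finAdjoin (Subtype.val : V → A) t))} [IsProbabilityMeasure P]
    (hconc : ∀ ε : ℝ, 0 < ε → ∃ δ : ℝ, 0 < δ ∧
      ∀ (a : V) (ha : (a : A) ∈ finAdjoin (Subtype.val : V → A) t), p a ≤ δ →
        P.real {α | 1 ≤ |α ⟨a, ha⟩|} ≤ ε)
    {δ ε : ℝ} (hδ : 0 < δ) (hε : 0 ≤ ε)
    (h : ∀ (a : V) (ha : (a : A) ∈ finAdjoin (Subtype.val : V → A) t), p a ≤ δ →
        P.real {α | 1 ≤ |α ⟨a, ha⟩|} ≤ ε) {C : ℝ} (hC : 0 < C) :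
    P.real (boundedChars (Subtype.val : V → A) (fun v => C * q v) t)ᶜ ≤
      10 * (ε + 2 * (p.traceRel q).toReal / (C ^ 2 * δ ^ 2)) := by
  have hfin : FiniteDimensional ℝ (Submodule.span ℝ (t : Set V)) :=
    FiniteDimensional.span_finset ℝ t
  have key := measureReal_not_forall_abs_le_le (P := P)
    (X := fun α => α.toLinearMap ∘ₗ spanToFinAdjoin V t)
    (fun v => (CharSpace.continuous_eval (spanToFinAdjoin V t v)).measurable)
    (hp.comp (Submodule.subtype _)) (hq.comp (Submodule.subtype _))
    (T := (p.traceRel q).toReal)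
    (fun s hs => by simpa using Seminorm.sum_sq_le_of_traceRel_lt_top hpq hs.map_subtype)
    (fun v hv => Seminorm.eq_zero_of_traceRel_lt_top hpq (v := (v : V)) hv)
    (fun ε hε => by
      obtain ⟨δ, hδ, h⟩ := hconc ε hε
      exact ⟨δ, hδ, fun z hz => h z.1 (spanToFinAdjoin V t z).2 hz⟩) hδ hε
    (fun z hz => h z.1 (spanToFinAdjoin V t z).2 hz) hC
  refine (measureReal_mono fun α hα hbound => ?_).trans key
  exact hα fun v hv => hbound ⟨v, Submodule.subset_span hv⟩

theorem exists_measureReal_compl_boundedChars_le {V : Submodule ℝ A} {p q : Seminorm ℝ V}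
    (hp : p.IsHilbertian) (hq : q.IsHilbertian) (hpq : p.traceRel q < ∞)
    {ν : ∀ S : FinGenBy V, Measure (CharSpace S.1)} [∀ S, IsProbabilityMeasure (ν S)]
    (hν : IsConcentrated V p ν) {ε : ℝ} (hε : 0 < ε) :
    ∃ n : ℕ, ∀ t : Finset V, (ν ⟨_, finAdjoin_mem_finGenBy V t⟩).real
      (boundedChars (Subtype.val : V → A) (fun v => n * q v) t)ᶜ ≤ ε := by
  have hreal : ∀ ε : ℝ, 0 < ε → ∃ δ : ℝ, 0 < δ ∧
      ∀ (t : Finset V) (a : V) (ha : (a : A) ∈ finAdjoin (Subtype.val : V → A) t), p a ≤ δ →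
        (ν ⟨_, finAdjoin_mem_finGenBy V t⟩).real {α | 1 ≤ |α ⟨a, ha⟩|} ≤ ε := by
    intro ε hε
    obtain ⟨δ, hδ, h⟩ := hν ε hε
    exact ⟨δ, hδ, fun t a ha hpa => ENNReal.toReal_le_of_le_ofReal hε.le
      (h ⟨_, finAdjoin_mem_finGenBy V t⟩ a ha hpa)⟩
  -- Both terms in the tightness bound are made at most `ε / 20`, to offset the factor `10`. The
  -- radius `m + 1` is positive even when `m = 0`.
  obtain ⟨δ, hδ, h⟩ := hreal (ε / 20) (by positivity)
  have hT0 : 0 ≤ (p.traceRel q).toReal := ENNReal.toReal_nonneg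
  obtain ⟨m, hm⟩ := exists_nat_ge (40 * (p.traceRel q).toReal / (ε * δ ^ 2))
  refine ⟨m + 1, fun t => ?_⟩
  have key := measureReal_compl_boundedChars_le hp hq hpq t
    (P := ν ⟨_, finAdjoin_mem_finGenBy V t⟩)
    (fun ε hε => (hreal ε hε).imp fun δ hδ => ⟨hδ.1, hδ.2 t⟩) hδ (by positivity : 0 ≤ ε / 20)
    (h t) (C := ((m + 1 : ℕ) : ℝ)) (by positivity)
  refine key.trans ?_
  have h1 : 2 * (p.traceRel q).toReal / (((m + 1 : ℕ) : ℝ) ^ 2 * δ ^ 2) ≤ ε / 20 := by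
    rw [div_le_iff₀ (by positivity)] at hm ⊢
    have hm1 : (m : ℝ) ≤ ((m + 1 : ℕ) : ℝ) ^ 2 := by
      push_cast
      nlinarith [sq_nonneg (m : ℝ), Nat.cast_nonneg (α := ℝ) m]
    have := mul_le_mul_of_nonneg_right hm1 (by positivity : 0 ≤ ε * δ ^ 2)
    linarith
  linarith

theorem exists_isRepresentingRadonMeasure_of_isConcentrated {V : Submodule ℝ A}
    (hV : Algebra.adjoin ℝ (V : Set A) = ⊤) {p q : Seminorm ℝ V}
    (hp : p.IsHilbertian) (hq : q.IsHilbertian) (hpq : p.traceRel q < ∞)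
    [Nonempty (CharSpace A)] {L : A →ₗ[ℝ] ℝ} (hL : L 1 = 1)
    {ν : ∀ S : FinGenBy V, Measure (CharSpace S.1)}
    (hν : ∀ S : FinGenBy V, IsRepresentingRadonMeasure (L ∘ₗ S.1.val.toLinearMap) (ν S))
    (hc : IsConcentrated V p ν) :
    ∃ μ : Measure (CharSpace A), IsRepresentingRadonMeasure L μ ∧ μ (contChars V q)ᶜ = 0 := by
  have hprob : ∀ S, IsProbabilityMeasure (ν S) := fun S =>
    (hν S).isProbabilityMeasure (by simpa using hL)
  obtain ⟨μ, hμ, hμ0⟩ := exists_isRepresentingRadonMeasure_of_tight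
    (u := (Subtype.val : V → A)) (by rwa [Subtype.range_coe]) (w := q) (fun v => apply_nonneg q v)
    hL (ν := fun t => ν ⟨_, finAdjoin_mem_finGenBy V t⟩) (fun t => hν ⟨_, finAdjoin_mem_finGenBy V t⟩)
    (fun ε hε => exists_measureReal_compl_boundedChars_le hp hq hpq hc hε)
  refine ⟨μ, hμ, measure_mono_null (Set.compl_subset_compl.mpr ?_) hμ0⟩
  rintro α ⟨n, hn⟩
  refine ⟨n + 1, by positivity, fun v => (hn v).trans ?_⟩
  have := apply_nonneg q v
  linarith

end Concentrated

/-! ### From a representing measure to a seminorm of finite trace -/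

theorem Seminorm.isHilbertian_normSeminorm (H : Type*) [NormedAddCommGroup H]
    [InnerProductSpace ℝ H] : (normSeminorm ℝ H).IsHilbertian :=
  ⟨innerₗ H, fun v w => real_inner_comm w v, fun v => real_inner_self_nonneg, fun v => by
    simp⟩

/-- Bessel's inequality: testing `f` on `v = ∑ f e • e` gives `f v = q v ^ 2 = S`, hence `S ^ 2 ≤ c
^ 2 * S`. -/
theorem Seminorm.IsFiniteOrthonormal.sum_sq_le {E : Type*} [AddCommGroup E] [Module ℝ E]
    {q : Seminorm ℝ E} (hq : q.IsHilbertian) {s : Finset E} (hs : q.IsFiniteOrthonormal s)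
    {f : E →ₗ[ℝ] ℝ} {c : ℝ} (hf : ∀ v, |f v| ≤ c * q v) : ∑ e ∈ s, f e ^ 2 ≤ c ^ 2 := by
  classical
  obtain ⟨B, hB⟩ := hq
  obtain ⟨hsym, h0, hqB⟩ := hB
  have hq2 : ∀ v, q v ^ 2 = B v v := fun v => by rw [hqB, Real.sq_sqrt (h0 v)]
  set v := ∑ e ∈ s, f e • e with hv
  set S := ∑ e ∈ s, f e ^ 2 with hS
  have hfv : f v = S := by simp [hv, hS, pow_two]
  have hqv : q v ^ 2 = S := by
    rw [hq2, hv, hS]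
    simp only [map_sum, LinearMap.sum_apply, map_smul, LinearMap.smul_apply, smul_eq_mul]
    refine Finset.sum_congr rfl fun e he => ?_
    rw [Finset.sum_eq_single_of_mem e he]
    · rw [← hq2, hs.2 e he]; ring
    · intro e' he' hne
      rw [← Seminorm.polarForm_eq hsym h0 hqB, hs.1 e' he' e he hne, mul_zero]
  have hS0 : 0 ≤ S := Finset.sum_nonneg fun e _ => sq_nonneg _
  rcases hS0.eq_or_lt with h | h
  · rw [← h]; positivity
  · have h1 := pow_le_pow_left₀ (abs_nonneg _) (hf v) 2
    rw [sq_abs, hfv, mul_pow, hqv, pow_two S] at h1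
    exact le_of_mul_le_mul_right h1 h

section Representing

variable {A : Type*} [CommRing A] [Algebra ℝ A]

theorem IsRepresentingRadonMeasure.map_restrict {L : A →ₗ[ℝ] ℝ} {ν : Measure (CharSpace A)}
    [IsFiniteMeasure ν] (h : IsRepresentingRadonMeasure L ν) (S : Subalgebra ℝ A) :
    IsRepresentingRadonMeasure (L ∘ₗ S.val.toLinearMap) (ν.map (CharSpace.restrict S)) := by
  have hm := (CharSpace.continuous_restrict S).measurable
  have hc : ∀ a : S, Measurable fun α : CharSpace S => α a := fun a =>
    (CharSpace.continuous_eval a).measurable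
  have := h.isRadon.innerRegular
  have hfin : IsFiniteMeasure (ν.map (CharSpace.restrict S)) := Measure.isFiniteMeasure_map _ _
  refine ⟨⟨IsFiniteMeasure.toIsLocallyFiniteMeasure _, .map_of_continuous (CharSpace.continuous_restrict S)⟩, fun a => ?_,
    fun a => ?_⟩
  · rw [integrable_map_measure (hc a).aestronglyMeasurable hm.aemeasurable]
    exact h.integrable a
  · rw [integral_map hm.aemeasurable (hc a).aestronglyMeasurable]
    exact h.integral_eq a

/-- A representing measure supported on the `q`-continuous characters gives rise to a Hilbertian
seminorm of finite trace that controls the concentration of the measure. -/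
theorem exists_traceRel_lt_top_of_isRepresentingRadonMeasure {V : Submodule ℝ A}
    {q : Seminorm ℝ V} (hq : q.IsHilbertian) {L : A →ₗ[ℝ] ℝ} {ν : Measure (CharSpace A)}
    [IsProbabilityMeasure ν] (h : IsRepresentingRadonMeasure L ν)
    (hν : ν (contChars V q)ᶜ = 0) :
    ∃ p : Seminorm ℝ V, p.IsHilbertian ∧ p.traceRel q < ∞ ∧
      ∀ ε : ℝ, 0 < ε → ∃ δ : ℝ, 0 < δ ∧ ∀ a : V, p a ≤ δ →
        ν {α | 1 ≤ |α (a : A)|} ≤ ENNReal.ofReal ε := by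
  classical
  set K : ℕ → Set (CharSpace A) := fun n => {α | ∀ v : V, |α (v : A)| ≤ n * q v} with hK
  have hKm : ∀ n, MeasurableSet (K n) := fun n =>
    (CharSpace.isClosed_setOf_abs_le (fun v : V => (v : A)) fun v => n * q v).measurableSet
  have hKmono : Monotone K := fun m n hmn α hα v =>
    (hα v).trans (mul_le_mul_of_nonneg_right (Nat.cast_le.mpr hmn) (apply_nonneg q v))
  have hKae : ∀ᵐ α ∂ν, α ∈ ⋃ n, K n := by
    refine measure_mono_null (Set.compl_subset_compl.mpr ?_) hν
    rintro α ⟨C, -, hC⟩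
    obtain ⟨n, hn⟩ := exists_nat_ge C
    exact Set.mem_iUnion_of_mem n fun v =>
      (hC v).trans (mul_le_mul_of_nonneg_right hn (apply_nonneg q v))
  -- Adjoining the exceptional null set makes `N` defined everywhere, with value `0` on that set.
  have hex : ∀ α : CharSpace A, ∃ n, α ∈ K n ∪ (⋃ n, K n)ᶜ := by
    intro α
    by_cases hα : α ∈ ⋃ n, K n
    · obtain ⟨n, hn⟩ := Set.mem_iUnion.mp hα
      exact ⟨n, Or.inl hn⟩
    · exact ⟨0, Or.inr hα⟩
  set N : CharSpace A → ℕ := fun α => Nat.find (hex α) with hN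
  have hNm : Measurable N := measurable_find hex fun n =>
    (hKm n).union (MeasurableSet.iUnion hKm).compl
  have hNK : ∀ α ∈ ⋃ n, K n, α ∈ K (N α) := fun α hα =>
    (Nat.find_spec (hex α)).resolve_right fun hc => hc hα
  have hNle : ∀ n, ∀ α ∈ K n, N α ≤ n := fun n α hα => Nat.find_min' (hex α) (Or.inl hα)
  have hwm : Measurable fun α => ((1 : ℝ) + N α)⁻¹ :=
    (measurable_const.add (measurable_from_nat.comp hNm)).inv
  have hL2 : ∀ v : V, MemLp (fun α : CharSpace A => ((1 : ℝ) + N α)⁻¹ * α (v : A)) 2 ν := by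
    intro v
    have hv : MemLp (fun α : CharSpace A => α (v : A)) 2 ν := by
      rw [memLp_two_iff_integrable_sq
        (CharSpace.continuous_eval (v : A)).measurable.aestronglyMeasurable]
      exact (h.integrable ((v : A) ^ 2)).congr (Eventually.of_forall fun α => map_pow α _ 2)
    refine hv.of_le (hwm.mul (CharSpace.continuous_eval (v : A)).measurable).aestronglyMeasurable
      (Eventually.of_forall fun α => ?_)
    rw [norm_mul]
    refine mul_le_of_le_one_left (norm_nonneg _) ?_
    rw [norm_inv, Real.norm_of_nonneg (by positivity)]
    exact inv_le_one_of_one_le₀ (by linarith [Nat.cast_nonneg (α := ℝ) (N α)])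
  let T : V →ₗ[ℝ] Lp ℝ 2 ν :=
  { toFun v := (hL2 v).toLp _
    map_add' v w := by
      rw [← MemLp.toLp_add]
      exact MemLp.toLp_congr _ _ (Eventually.of_forall fun α => by simp [mul_add])
    map_smul' c v := by
      rw [RingHom.id_apply, ← MemLp.toLp_const_smul]
      exact MemLp.toLp_congr _ _ (Eventually.of_forall fun α => by simp; ring) }
  set p : Seminorm ℝ V := (normSeminorm ℝ (Lp ℝ 2 ν)).comp T with hp
  have hpsq : ∀ v, p v ^ 2 = ∫ α, (((1 : ℝ) + N α)⁻¹ * α (v : A)) ^ 2 ∂ν := by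
    intro v
    change ‖T v‖ ^ 2 = _
    rw [← real_inner_self_eq_norm_sq, L2.inner_def]
    refine integral_congr_ae ?_
    filter_upwards [(hL2 v).coeFn_toLp] with α hα
    change inner ℝ ((hL2 v).toLp _ α) ((hL2 v).toLp _ α) = _
    rw [hα, real_inner_self_eq_norm_sq, Real.norm_eq_abs, sq_abs]
  have hint : ∀ v : V, Integrable (fun α => (((1 : ℝ) + N α)⁻¹ * α (v : A)) ^ 2) ν := fun v =>
    (hL2 v).integrable_sq
  refine ⟨p, (Seminorm.isHilbertian_normSeminorm _).comp T, ?_, fun ε hε => ?_⟩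
  · have hker : ∀ v, q v = 0 → p v = 0 := by
      intro v hv
      rw [← sq_eq_zero_iff, hpsq]
      refine integral_eq_zero_of_ae ?_
      filter_upwards [hKae] with α hα
      have := hNK α hα v
      rw [hv, mul_zero, abs_nonpos_iff] at this
      simp [this]
    rw [Seminorm.traceRel, if_pos hker]
    refine lt_of_le_of_lt (iSup₂_le fun s hs => ?_) ENNReal.one_lt_top
    rw [← ENNReal.ofReal_sum_of_nonneg fun e _ => sq_nonneg _, ENNReal.ofReal_le_one]
    simp only [hpsq]
    rw [← integral_finsetSum _ fun e _ => hint e]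
    -- Pointwise, Bessel bounds `∑ α e ^ 2` by `N α ^ 2`, which the weight `(1 + N α)⁻¹ ^ 2` brings
    -- below `1`.
    calc ∫ α, ∑ e ∈ s, (((1 : ℝ) + N α)⁻¹ * α (e : A)) ^ 2 ∂ν ≤ ∫ _, (1 : ℝ) ∂ν := by
          refine integral_mono_ae (integrable_finsetSum _ fun e _ => hint e)
            (integrable_const 1) ?_
          filter_upwards [hKae] with α hα
          have h1 := hs.sum_sq_le hq (f := α.toLinearMap ∘ₗ V.subtype) (hNK α hα)
          simp only [mul_pow, ← Finset.mul_sum]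
          rw [inv_pow, inv_mul_le_iff₀ (by positivity), mul_one]
          refine h1.trans (pow_le_pow_left₀ (Nat.cast_nonneg _) (by linarith) 2)
      _ = 1 := by simp
  · obtain ⟨n, hn⟩ : ∃ n, ν.real (K n)ᶜ ≤ ε / 2 := by
      have h1 : ν (⋃ n, K n) = 1 := by
        rw [← prob_compl_eq_zero_iff (MeasurableSet.iUnion hKm)]; exact hKae
      have h2 : Tendsto (fun n => ν.real (K n)) atTop (𝓝 1) := by
        have h3 := tendsto_measure_iUnion_atTop (μ := ν) hKmono
        rw [h1] at h3
        exact (ENNReal.tendsto_toReal ENNReal.one_ne_top).comp h3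
      obtain ⟨n, hn⟩ := (h2.eventually (lt_mem_nhds (by linarith : 1 - ε / 2 < 1))).exists
      refine ⟨n, ?_⟩
      rw [probReal_compl_eq_one_sub (hKm n)]
      linarith
    -- On `K n` the weight is at least `1 / (1 + n)`, so Chebyshev bounds the event there by `(1 +
    -- n) ^ 2 * p a ^ 2`, at most `ε / 2` for this `δ`.
    refine ⟨Real.sqrt (ε / 2) / (1 + n), by positivity, fun a ha => ?_⟩
    rw [← ofReal_measureReal]
    refine ENNReal.ofReal_le_ofReal ?_
    set G := {α : CharSpace A | (((1 : ℝ) + n) ^ 2)⁻¹ ≤ (((1 : ℝ) + N α)⁻¹ * α (a : A)) ^ 2}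
    have hsub : {α : CharSpace A | 1 ≤ |α (a : A)|} ⊆ (K n)ᶜ ∪ G := by
      intro α hα
      by_cases hαn : α ∈ K n
      · refine Or.inr ?_
        change (((1 : ℝ) + n) ^ 2)⁻¹ ≤ (((1 : ℝ) + N α)⁻¹ * α (a : A)) ^ 2
        have h1 : (N α : ℝ) ≤ n := Nat.cast_le.mpr (hNle n α hαn)
        have h2 : 1 ≤ α (a : A) ^ 2 := by
          rw [← sq_abs]; exact one_le_pow₀ hα
        have h3 : (((1 : ℝ) + n) ^ 2)⁻¹ ≤ (((1 : ℝ) + N α) ^ 2)⁻¹ := by gcongr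
        rw [mul_pow, inv_pow]
        exact h3.trans (le_mul_of_one_le_right (by positivity) h2)
      · exact Or.inl hαn
    have hG : ν.real G ≤ ε / 2 := by
      have h1 := mul_meas_ge_le_integral_of_nonneg (Eventually.of_forall fun α => sq_nonneg _)
        (hint a) (((1 : ℝ) + n) ^ 2)⁻¹
      rw [← hpsq, inv_mul_le_iff₀ (by positivity)] at h1
      refine h1.trans ?_
      have h2 := pow_le_pow_left₀ (apply_nonneg p a) ha 2
      rw [div_pow, Real.sq_sqrt (by positivity), le_div_iff₀ (by positivity)] at h2
      linarith
    calc ν.real {α : CharSpace A | 1 ≤ |α (a : A)|} ≤ ν.real ((K n)ᶜ ∪ G) :=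
          measureReal_mono hsub
      _ ≤ ν.real (K n)ᶜ + ν.real G := measureReal_union_le _ _
      _ ≤ ε := by linarith

end Representing

end

theorem mainTheorem1 {A : Type*} [CommRing A] [Algebra ℝ A]
    (V : Submodule ℝ A) (hV : Algebra.adjoin ℝ (V : Set A) = ⊤)
    (q : Seminorm ℝ V) (hq : q.IsHilbertian) (hne : (contChars V q).Nonempty)
    (L : A →ₗ[ℝ] ℝ) (hL : L 1 = 1) :
    (∃ ν : Measure (CharSpace A),
        IsRepresentingRadonMeasure L ν ∧ ν (contChars V q)ᶜ = 0) ↔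
      ∃ p : Seminorm ℝ V, p.IsHilbertian ∧ p.traceRel q < ∞ ∧
        ∃ ν : ∀ S : FinGenBy V, Measure (CharSpace S.1),
          (∀ S : FinGenBy V,
            IsRepresentingRadonMeasure (L ∘ₗ S.1.val.toLinearMap) (ν S)) ∧
          IsConcentrated V p ν := by
  constructor
  · rintro ⟨ν, hν, hν0⟩
    have := hν.isProbabilityMeasure hL
    obtain ⟨p, hp, hpq, hc⟩ := exists_traceRel_lt_top_of_isRepresentingRadonMeasure hq hν hν0
    refine ⟨p, hp, hpq, fun S => ν.map (CharSpace.restrict S.1), fun S => hν.map_restrict S.1,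
      fun ε hε => ?_⟩
    obtain ⟨δ, hδ, h⟩ := hc ε hε
    refine ⟨δ, hδ, fun S a ha hpa => ?_⟩
    rw [Measure.map_apply (CharSpace.continuous_restrict S.1).measurable
      (measurableSet_le measurable_const (CharSpace.continuous_eval _).measurable.abs)]
    exact h a hpa
  · rintro ⟨p, hp, hpq, ν, hν, hc⟩
    -- Some character must exist to serve as the default value of the inverse embedding off the
    -- balls.
    have : Nonempty (CharSpace A) := ⟨hne.some⟩
    exact exists_isRepresentingRadonMeasure_of_isConcentrated hV hp hq hpq hL hν hc
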